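/- **Setting.** A mould $Z$ with values in a commutative $\mathbb{Q}$-algebra $\mathcal A$ is a family $Z(X_1,\dots,X_r)=\sum_{k_1,\dots,k_r\ge 1} z(k_1,\dots,k_r)X_1^{k_1-1}\cdots X_r^{k_r-1}\in\mathcal A[[X_1,\dots,X_r]]$ ($r\ge 0$), and a bimould $B$ is a family $B\binom{X_1,\dots,X_r}{Y_1,\dots,Y_r}\in\mathcal A[[X_1,\dots,X_r,Y_1,\dots,Y_r]]$ ($r\ge0$); the part of depth $0$ is always $1$. Products are $(Z_1\times Z_2)(X_1,\dots,X_r)=\sum_{j=0}^r Z_1(X_1,\dots,X_j)Z_2(X_{j+1},\dots,X_r)$, and likewise for bimoulds. A power series $\sum_r a_rT^r$ is regarded as the constant (bi)mould equal to $a_r$ in depth $r$. For a product $\diamond$ on the $\mathbb{Q}$-span of the letters $z_k$ $(k\ge1)$, the quasi-shuffle product on the words in these letters is the bilinear product with ${\bf 1}$ as unit and $aw * bv=a(w*bv)+b(aw*v)+(a\diamond b)(w*v)$ for letters $a,b$ and words $w,v$. The mould $Z$ is symmetril (resp. symmetral) if $z_{k_1}\cdots z_{k_r}\mapsto z(k_1,\dots,k_r)$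 is a homomorphism of unital algebras for $z_k\diamond z_l=z_{k+l}$ (resp. $z_k\diamond z_l=0$). Put $Z_\gamma=Z^\sharp\times\exp\big(\sum_{n\ge2}\frac{(-1)^n}{n}z(n)T^n\big)$ with $Z^\sharp(X_1,\dots,X_r)=Z(X_1+\dots+X_r,\dots,X_1+X_2,X_1)$. The mould $Z$ satisfies the extended double shuffle equations if $Z$ is symmetril and $Z_\gamma$ is symmetral. Let $\mathfrak b$ be any $\mathbb{Q}$-valued mould that satisfies the extended double shuffle equations and whose depth one part is $\mathfrak b(X)=-\sum_{k\ge2}\frac{B_k}{2\,k!}X^{k-1}$, where $B_k$ are the Bernoulli numbers. Define the bimoulds $$\mathfrak b\binom{X_1,\dots,X_r}{Y_1,\dots,Y_r}=\sum_{j=0}^r\mathfrak b_\gamma(Y_1,\dots,Y_j)\,\mathfrak b(X_{j+1},\dots,X_r),$$ $$\tilde{\mathfrak b}\binom{X_1,\dots,X_r}{Y_1,\dots,Y_r}=\sum_{i=0}^r\frac{(-1)^i}{2^i\,i!}\,\mathfrak b\binom{X_{i+1},\dots,X_r}{-Y_1,\dots,-Y_{r-i}},$$ and, for $m\ge1$ and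 $L_m\binom{X}{Y}=\frac{e^{X+mY}q^m}{1-e^Xq^m}$, $$\mathfrak L_m\binom{X_1,\dots,X_r}{Y_1,\dots,Y_r}=\sum_{j=1}^r\mathfrak b\binom{X_1-X_j,\dots,X_{j-1}-X_j}{Y_1,\dots,Y_{j-1}}\,L_m\binom{X_j}{Y_1+\dots+Y_r}\,\tilde{\mathfrak b}\binom{X_r-X_j,\dots,X_{j+1}-X_j}{Y_r,\dots,Y_{j+1}}\qquad(r\ge 1),$$ $$\mathfrak g^*\binom{X_1,\dots,X_r}{Y_1,\dots,Y_r}=\sum_{\substack{1\le j\le r\\0=r_0<r_1<\dots<r_j=r\\m_1>\dots>m_j>0}}\ \prod_{i=1}^j\mathfrak L_{m_i}\binom{X_{r_{i-1}+1},\dots,X_{r_i}}{Y_{r_{i-1}+1},\dots,Y_{r_i}}\qquad(r\ge 1).$$ The combinatorial bi-multiple Eisenstein series $G\binom{k_1,\dots,k_r}{d_1,\dots,d_r}\in\mathbb{Q}[[q]]$ $(k_i\ge1,\ d_i\ge0)$ are the coefficients in $$(\mathfrak g^*\times\mathfrak b)\binom{X_1,\dots,X_r}{Y_1,\dots,Y_r}=\sum_{k_i\ge1,\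 d_i\ge0}G\binom{k_1,\dots,k_r}{d_1,\dots,d_r}X_1^{k_1-1}\cdots X_r^{k_r-1}\frac{Y_1^{d_1}}{d_1!}\cdots\frac{Y_r^{d_r}}{d_r!}.$$ **Proposition 5.4.** For all $k_1,k_2\ge1$ and $d_1,d_2\ge0$, $$G\binom{k_1}{d_1}G\binom{k_2}{d_2}=G\binom{k_1,k_2}{d_1,d_2}+G\binom{k_2,k_1}{d_2,d_1}+G\binom{k_1+k_2}{d_1+d_2}$$ $$=\sum_{\substack{l_1+l_2=k_1+k_2\\e_1+e_2=d_1+d_2\\l_1,l_2\ge1,\ e_1,e_2\ge0}}\left(\binom{l_1-1}{k_1-1}\binom{d_1}{e_1}(-1)^{d_1-e_1}+\binom{l_1-1}{k_2-1}\binom{d_2}{e_1}(-1)^{d_2-e_1}\right)G\binom{l_1,l_2}{e_1,e_2}$$ $$\qquad+\frac{d_1!\,d_2!}{(d_1+d_2+1)!}\binom{k_1+k_2-2}{k_1-1}\,G\binom{k_1+k_2-1}{d_1+d_2+1},$$ where the two-row symbols directly after $G$ are its indices, and the others are binomial coefficients, with $\binom{a}{b}=0$ for $b>a\ge0$. -/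

import Mathlib

noncomputable section

namespace CombEis

/-! ### Quasi-shuffle algebras -/

/-- `ℚ⟨L⟩` as the `ℚ`-vector space with basis the words (lists) in the alphabet `L`. -/
abbrev WordSpace (L : Type*) := List L →₀ ℚ

/-- Left concatenation `w ↦ a w` with a letter, extended linearly to `ℚ⟨L⟩`. -/
def consLetter {L : Type*} (a : L) (f : WordSpace L) : WordSpace L :=
  Finsupp.mapDomain (List.cons a) f

/-- The quasi-shuffle product `w ∗_⋄ v` of two words, for a product `⋄` on `ℚ L`
given on letters by `dia : L → L → ℚ L`. -/
def qshWord {L : Type*} (dia : L → L → (L →₀ ℚ)) : List L → List L → WordSpace L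
  | [], v => Finsupp.single v 1
  | a :: w, [] => Finsupp.single (a :: w) 1
  | a :: w, b :: v =>
      consLetter a (qshWord dia w (b :: v)) + consLetter b (qshWord dia (a :: w) v)
        + (dia a b).sum fun c x => x • consLetter c (qshWord dia w v)
termination_by w v => w.length + v.length

/-- The quasi-shuffle product on `ℚ⟨L⟩`, extended bilinearly from words. -/
def qsh {L : Type*} (dia : L → L → (L →₀ ℚ)) (f g : WordSpace L) : WordSpace L :=
  f.sum fun w x => g.sum fun v y => (x * y) • qshWord dia w v

/-- `z_k ⋄ z_l = z_{k+l}` on the alphabet `{z_k ∣ k ≥ 1}` (indexed by `ℕ+`). -/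
def stuffleDia (k l : ℕ+) : ℕ+ →₀ ℚ := Finsupp.single (k + l) 1

/-- `z_k ⋄ z_l = 0`: the corresponding quasi-shuffle product is the shuffle product. -/
def shuffleDia (_ _ : ℕ+) : ℕ+ →₀ ℚ := 0

/-! ### Moulds -/

/-- A mould with values in `A`: in each depth `r` a power series in `X_1, …, X_r`. -/
def Mould (A : Type*) := (r : ℕ) → MvPowerSeries (Fin r) A

namespace Mould

variable {A : Type*} [CommRing A] [Algebra ℚ A]

/-- The coefficient `z(k_1, …, k_r)` of `X_1^{k_1-1} ⋯ X_r^{k_r-1}`. -/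
def coeff (Z : Mould A) (k : List ℕ+) : A :=
  MvPowerSeries.coeff (Finsupp.equivFunOnFinite.symm fun i => (k.get i : ℕ) - 1) (Z k.length)

/-- The coefficient map `φ_Z : ℚ⟨L_z⟩ → A`, `z_{k_1} ⋯ z_{k_r} ↦ z(k_1, …, k_r)`. -/
def coeffMap (Z : Mould A) : WordSpace ℕ+ →ₗ[ℚ] A :=
  Finsupp.linearCombination ℚ Z.coeff

/-- `Z` is `⋄`-symmetril: the coefficient map is a homomorphism of unital algebras
from the quasi-shuffle algebra of `⋄` to `A`. -/
def IsDiaSymmetril (dia : ℕ+ → ℕ+ → (ℕ+ →₀ ℚ)) (Z : Mould A) : Prop :=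
  Z.coeffMap (Finsupp.single [] 1) = 1 ∧
    ∀ f g : WordSpace ℕ+, Z.coeffMap (qsh dia f g) = Z.coeffMap f * Z.coeffMap g

def IsSymmetril (Z : Mould A) : Prop := Z.IsDiaSymmetril stuffleDia

def IsSymmetral (Z : Mould A) : Prop := Z.IsDiaSymmetril shuffleDia

/-- Evaluation `Z(x_1, …, x_r)` of the depth `r` part at power series without constant term. -/
def eval {R τ : Type*} [CommRing R] [Algebra A R] (Z : Mould A) {r : ℕ}
    (x : Fin r → MvPowerSeries τ R) : MvPowerSeries τ R :=
  MvPowerSeries.subst x (Z r)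

/-- The product of moulds,
`(Z₁ × Z₂)(X_1, …, X_r) = ∑_{j=0}^r Z₁(X_1, …, X_j) Z₂(X_{j+1}, …, X_r)`. -/
def mul (Z₁ Z₂ : Mould A) : Mould A := fun r =>
  ∑ j : Fin (r + 1),
    Z₁.eval (fun i : Fin j => (MvPowerSeries.X ⟨i, by omega⟩ : MvPowerSeries (Fin r) A)) *
    Z₂.eval (fun i : Fin (r - j) =>
      (MvPowerSeries.X ⟨j + i, by omega⟩ : MvPowerSeries (Fin r) A))

/-- The constant mould of a power series `F = ∑ a_r T^r`: equal to `a_r` in depth `r`. -/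
def const (F : PowerSeries A) : Mould A := fun r =>
  MvPowerSeries.C (PowerSeries.coeff r F)

/-- `Z^♯(X_1, …, X_r) = Z(X_1 + ⋯ + X_r, …, X_1 + X_2, X_1)`. -/
def sharp (Z : Mould A) : Mould A := fun r =>
  Z.eval fun i : Fin r =>
    ∑ j ∈ Finset.univ.filter (fun j : Fin r => (j : ℕ) + i < r),
      (MvPowerSeries.X j : MvPowerSeries (Fin r) A)

/-- `Z^-(X_1, …, X_r) = Z(-X_1, …, -X_r)`. -/
def minus (Z : Mould A) : Mould A := fun r =>
  Z.eval fun i : Fin r => (-MvPowerSeries.X i : MvPowerSeries (Fin r) A)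

/-- `Γ^Z = exp (∑_{n ≥ 2} (-1)^n / n · z(n) T^n)`. -/
def gammaSeries (Z : Mould A) : PowerSeries A :=
  (PowerSeries.exp ℚ).subst
    (PowerSeries.mk fun n : ℕ =>
      if h : 2 ≤ n then ((-1 : ℚ) ^ n / n) • Z.coeff [⟨n, by omega⟩] else 0 : PowerSeries A)

/-- `Z_γ = Z^♯ × Γ^Z`. -/
def gam (Z : Mould A) : Mould A := Z.sharp.mul (const Z.gammaSeries)

/-- The extended double shuffle equations: `Z` is symmetril and `Z_γ` is symmetral. -/
def SatisfiesEDS (Z : Mould A) : Prop := Z.IsSymmetril ∧ Z.gam.IsSymmetral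

end Mould

/-! ### Bimoulds -/

/-- A bimould with values in `A`: in each depth `r` a power series in
`X_1, …, X_r` (the left summand) and `Y_1, …, Y_r` (the right summand). -/
def Bimould (A : Type*) := (r : ℕ) → MvPowerSeries (Fin r ⊕ Fin r) A

/-- The variable `X_{i+1}` in depth `r`. -/
abbrev vX (A : Type*) [CommRing A] {r : ℕ} (i : Fin r) : MvPowerSeries (Fin r ⊕ Fin r) A :=
  MvPowerSeries.X (Sum.inl i)

/-- The variable `Y_{i+1}` in depth `r`. -/
abbrev vY (A : Type*) [CommRing A] {r : ℕ} (i : Fin r) : MvPowerSeries (Fin r ⊕ Fin r) A :=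
  MvPowerSeries.X (Sum.inr i)

namespace Bimould

variable {A : Type*} [CommRing A] [Algebra ℚ A]

/-- The coefficients `b(k_1, …, k_r; d_1, …, d_r)` of a bimould: its depth `r` part is
`∑ b(k; d) X_1^{k_1-1} ⋯ X_r^{k_r-1} Y_1^{d_1}/d_1! ⋯ Y_r^{d_r}/d_r!` (all `k_i ≥ 1`). -/
def coeff (B : Bimould A) {r : ℕ} (k d : Fin r → ℕ) : A :=
  (∏ i, (d i).factorial) •
    MvPowerSeries.coeff (Finsupp.equivFunOnFinite.symm (Sum.elim (fun i => k i - 1) d)) (B r)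

/-- Evaluation of the depth `r` part at `X_i = x_i`, `Y_i = y_i`, where the `x_i`, `y_i` are
power series without constant term (possibly with coefficients in an `A`-algebra). -/
def eval {R τ : Type*} [CommRing R] [Algebra A R] (B : Bimould A) {r : ℕ}
    (x y : Fin r → MvPowerSeries τ R) : MvPowerSeries τ R :=
  MvPowerSeries.subst (Sum.elim x y) (B r)

/-- The product of bimoulds, `(B × C)(X_1, …, X_r; Y_1, …, Y_r) =
∑_{j=0}^r B(X_1, …, X_j; Y_1, …, Y_j) C(X_{j+1}, …, X_r; Y_{j+1}, …, Y_r)`, as a bimould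
with values in a common algebra `A` over the coefficient rings of `B` and `C`. -/
def mul {A₁ A₂ : Type*} [CommRing A₁] [CommRing A₂] [Algebra A₁ A] [Algebra A₂ A]
    (B : Bimould A₁) (C : Bimould A₂) : Bimould A := fun r =>
  ∑ j : Fin (r + 1),
    B.eval (fun i : Fin j => vX A (⟨i, by omega⟩ : Fin r))
      (fun i : Fin j => vY A (⟨i, by omega⟩ : Fin r)) *
    C.eval (fun i : Fin (r - j) => vX A (⟨j + i, by omega⟩ : Fin r))
      (fun i : Fin (r - j) => vY A (⟨j + i, by omega⟩ : Fin r))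

/-- The constant bimould of a power series `F = ∑ a_r T^r`. -/
def const (F : PowerSeries A) : Bimould A := fun r =>
  MvPowerSeries.C (PowerSeries.coeff r F)

/-- The bimould `X^Z(X_1, …, X_r; Y_1, …, Y_r) = Z(X_1, …, X_r)`. -/
def ofX (Z : Mould A) : Bimould A := fun r => Z.eval fun i : Fin r => vX A i

/-- The bimould `Y^Z(X_1, …, X_r; Y_1, …, Y_r) = Z(Y_1, …, Y_r)`. -/
def ofY (Z : Mould A) : Bimould A := fun r => Z.eval fun i : Fin r => vY A i

/-- The bimould `B^Z = Y^{Z_γ} × X^Z`. -/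
def ofMould (Z : Mould A) : Bimould A := (ofY Z.gam).mul (ofX Z)

end Bimould

/-! ### The rational solution of the extended double shuffle equations -/

/-- A `ℚ`-valued mould that satisfies the extended double shuffle equations and whose depth one
part is `-∑_{k ≥ 2} B_k / (2 k!) X^{k-1}`. -/
structure IsRationalSolution (β : Mould ℚ) : Prop where
  eds : β.SatisfiesEDS
  depth_one : ∀ k : ℕ+,
    β.coeff [k] = if k = 1 then 0 else -bernoulli (k : ℕ) / (2 * ((k : ℕ).factorial : ℚ))

/-! ### Combinatorial bi-multiple Eisenstein series -/

/-- The bimould `b̃ = Y^{β_γ^-} × exp(-T/2) × X^β`. -/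
def bTilde (β : Mould ℚ) : Bimould ℚ :=
  ((Bimould.ofY β.gam.minus).mul
    (Bimould.const (PowerSeries.rescale (-1 / 2 : ℚ) (PowerSeries.exp ℚ))) : Bimould ℚ).mul
  (Bimould.ofX β)

/-- The ring `ℚ⟦q⟧`. -/
abbrev QSer := PowerSeries ℚ

/-- `exp(x)` for a power series `x` without constant term. -/
def mvExp {τ : Type*} (x : MvPowerSeries τ QSer) : MvPowerSeries τ QSer :=
  (PowerSeries.exp ℚ).subst x

/-- `q^m` as a constant power series. -/
def qPow (τ : Type*) (m : ℕ) : MvPowerSeries τ QSer :=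
  MvPowerSeries.C ((PowerSeries.X : QSer) ^ m)

/-- `L_m(x; y) = e^{x + m y} q^m / (1 - e^x q^m)`, for power series `x`, `y` without constant
term. For `m ≥ 1` the denominator is a unit, see `isUnit_denominator`. -/
def Lser {τ : Type*} (m : ℕ) (x y : MvPowerSeries τ QSer) : MvPowerSeries τ QSer :=
  mvExp (x + m • y) * qPow τ m * Ring.inverse (1 - mvExp x * qPow τ m)

theorem isUnit_denominator {τ : Type*} {m : ℕ} (hm : 1 ≤ m) (x : MvPowerSeries τ QSer) :
    IsUnit (1 - mvExp x * qPow τ m) := by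
  rw [MvPowerSeries.isUnit_iff_constantCoeff, PowerSeries.isUnit_iff_constantCoeff]
  have h : m ≠ 0 := by omega
  simp [qPow, h]

/-- The bimould `𝔏_m`: in depth `r` it is the sum over `j` of
`b(X_1 - X_j, …, X_{j-1} - X_j; Y_1, …, Y_{j-1}) · L_m(X_j; Y_1 + ⋯ + Y_r) ·
 b̃(X_r - X_j, …, X_{j+1} - X_j; Y_r, …, Y_{j+1})`, where `b = B^β`. -/
def frakL (β : Mould ℚ) (m : ℕ) : Bimould QSer := fun r =>
  ∑ j : Fin r,
    (Bimould.ofMould β).eval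
      (fun i : Fin j => vX QSer (⟨i, by omega⟩ : Fin r) - vX QSer j)
      (fun i : Fin j => vY QSer (⟨i, by omega⟩ : Fin r)) *
    Lser m (vX QSer j) (∑ i : Fin r, vY QSer i) *
    (bTilde β).eval
      (fun i : Fin (r - 1 - j) => vX QSer (⟨r - 1 - i, by omega⟩ : Fin r) - vX QSer j)
      (fun i : Fin (r - 1 - j) => vY QSer (⟨r - 1 - i, by omega⟩ : Fin r))

/-- The term of `𝔤^∗` in depth `r` for a decomposition of `(1, …, r)` into consecutive non-empty
blocks and indices `m_1, …, m_j`: the product over `i` of `𝔏_{m_i}` at the variables of the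
`i`-th block. -/
def gStarTerm (β : Mould ℚ) {r : ℕ} (c : Composition r) (m : Fin c.length → ℕ) :
    MvPowerSeries (Fin r ⊕ Fin r) QSer :=
  ∏ i : Fin c.length,
    (frakL β (m i)).eval (fun t => vX QSer (c.embedding i t)) (fun t => vY QSer (c.embedding i t))

/-- The bimould `𝔤^∗`: the sum of the above terms over all decompositions into blocks and
all `m_1 > ⋯ > m_j > 0`. The sum over the `m_i` is infinite and converges `q`-adically: for the
coefficient of `q^n` only the finitely many terms with all `m_i ≤ n` matter, see
`coeff_gStarTerm_eq_zero`. -/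
def gStar (β : Mould ℚ) : Bimould QSer := fun r e =>
  PowerSeries.mk fun n =>
    ∑ c : Composition r,
      ∑ m ∈ (Fintype.piFinset fun _ : Fin c.length => Finset.Icc 1 n) with StrictAnti m,
        PowerSeries.coeff n (MvPowerSeries.coeff e (gStarTerm β c m))

/-- A term of `𝔤^∗` in which some `m_i` exceeds `n` does not contribute to `q^n`. -/
theorem coeff_gStarTerm_eq_zero (β : Mould ℚ) {r : ℕ} (c : Composition r)
    (m : Fin c.length → ℕ) {n : ℕ} (i : Fin c.length) (hi : n < m i)
    (e : Fin r ⊕ Fin r →₀ ℕ) :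
    PowerSeries.coeff n (MvPowerSeries.coeff e (gStarTerm β c m)) = 0 := by
  have h1 : ∀ s : ℕ, ∃ f : MvPowerSeries (Fin s ⊕ Fin s) QSer, frakL β (m i) s = qPow _ (m i) * f := by
    intro s
    change qPow _ (m i) ∣ frakL β (m i) s
    refine Finset.dvd_sum fun j _ => ?_
    refine Dvd.dvd.mul_right (Dvd.dvd.mul_left ?_ _) _
    exact Dvd.dvd.mul_right (Dvd.intro_left _ rfl) _
  have h2 : qPow _ (m i) ∣ gStarTerm β c m := by
    refine Dvd.dvd.trans ?_ (Finset.dvd_prod_of_mem _ (Finset.mem_univ i))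
    obtain ⟨f, hf⟩ := h1 (c.blocksFun i)
    have hs : MvPowerSeries.HasSubst (Sum.elim (fun t => vX QSer (c.embedding i t))
        (fun t => vY QSer (c.embedding i t))) := by
      refine MvPowerSeries.hasSubst_of_constantCoeff_zero ?_
      rintro (t | t) <;> simp
    unfold Bimould.eval
    rw [hf, MvPowerSeries.subst_mul hs]
    refine Dvd.dvd.mul_right (dvd_of_eq ?_) _
    unfold qPow
    rw [MvPowerSeries.subst_C]
  obtain ⟨f, hf⟩ := h2
  rw [hf, qPow, MvPowerSeries.coeff_C_mul, PowerSeries.coeff_X_pow_mul', if_neg (by omega)]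

/-- The bimould `𝔊 = 𝔤^∗ × b`, where `b = B^β`. -/
def frakG (β : Mould ℚ) : Bimould QSer := (gStar β).mul (Bimould.ofMould β)

/-- The combinatorial bi-multiple Eisenstein series
`G(k_1, …, k_r; d_1, …, d_r) ∈ ℚ⟦q⟧`, for `k_i ≥ 1` and `d_i ≥ 0`. -/
def G (β : Mould ℚ) {r : ℕ} (k d : Fin r → ℕ) : QSer := (frakG β).coeff k d

end CombEis

end

noncomputable section

/-! ### Substitution into moulds, bimoulds and their products -/

namespace CombEis

variable {τ : Type*}

/-! Both formulas are coefficient comparisons in two functional equations of the generating series 𝔊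
= 𝔤^∗ × 𝔟 in depths one and two. The first is a quasi-shuffle relation, `frakG_mul_frakG`: the
product 𝔊(x₁;y₁)𝔊(x₂;y₂) is 𝔊(x₁,x₂;y₁,y₂) + 𝔊(x₂,x₁;y₂,y₁) plus the divided difference of
𝔊(·;y₁+y₂) at x₁, x₂. The second is swap invariance, `frakG_swap_one` and `frakG_swap_two`: 𝔊(x;y) =
𝔊(y;x) and 𝔊(x₁,x₂;y₁,y₂) = 𝔊(y₁+y₂,y₁;x₂,x₁-x₂). The quasi-shuffle relation gives the first
formula. Exchanging the X- and Y-variables in it and applying the swap to every term gives the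
second.

For the quasi-shuffle relation, the product of two sums over m splits into m₁ > m₂, m₁ < m₂ and the
diagonal terms L_m(x₁;y₁)L_m(x₂;y₂). Partial fractions turn a diagonal term into L_m(x₁;y₁+y₂) and
L_m(x₂;y₁+y₂) with coefficients built from 1/(e^u-1), u = x₂-x₁, and the prescribed depth one part β
of 𝔟 satisfies 1/(e^u-1) = 1/u - 1/2 - 2β(u). The pole 1/u yields the divided difference, and the
rest is supplied by the depth two part of 𝔏_m (`Lser_mul_Lser`). What remains is free of q: it
follows from symmetrility of 𝔟 and symmetrality of 𝔟_γ in depth two.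

For the swap, expanding L_m(x;y) = ∑_n e^{nx+my}q^{mn} makes the depth one sum symmetric, and the
sum over m₁ > m₂ is invariant under conjugation of partitions (`modq_ggTrunc_swap`). The other terms
match because β is odd.

The sums over m are infinite, so both equations are proved modulo q^{N+1} for every N, with m cut
off at N. -/

theorem Mould.eval_eval {A S R υ : Type*} [CommRing A] [Algebra ℚ A] [CommRing S] [CommRing R]
    [Algebra A S] [Algebra A R] [Algebra S R] [IsScalarTower A S R] [Finite υ]
    (Z : Mould A) {r : ℕ} (x : Fin r → MvPowerSeries υ S)
    (y : υ → MvPowerSeries τ R) (hx : ∀ i, (x i).constantCoeff = 0)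
    (hy : ∀ i, (y i).constantCoeff = 0) :
    MvPowerSeries.subst y (Z.eval x) = Z.eval fun i => MvPowerSeries.subst y (x i) :=
  MvPowerSeries.subst_comp_subst_apply (MvPowerSeries.hasSubst_of_constantCoeff_zero hx)
    (MvPowerSeries.hasSubst_of_constantCoeff_zero hy) _

/-- The rings `A`, `S`, `R` are kept apart because 𝔟 has rational coefficients while its arguments
may lie over ℚ⟦q⟧. -/
theorem Bimould.eval_eval {A S R υ : Type*} [CommRing A] [Algebra ℚ A] [CommRing S] [CommRing R]
    [Algebra A S] [Algebra A R] [Algebra S R] [IsScalarTower A S R] [Finite υ]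
    (B : Bimould A) {r : ℕ} (x y : Fin r → MvPowerSeries υ S)
    (z : υ → MvPowerSeries τ R) (hx : ∀ i, (x i).constantCoeff = 0)
    (hy : ∀ i, (y i).constantCoeff = 0) (hz : ∀ i, (z i).constantCoeff = 0) :
    MvPowerSeries.subst z (B.eval x y) =
      B.eval (fun i => MvPowerSeries.subst z (x i)) (fun i => MvPowerSeries.subst z (y i)) := by
  unfold Bimould.eval
  rw [MvPowerSeries.subst_comp_subst_apply (MvPowerSeries.hasSubst_of_constantCoeff_zero ?_)
    (MvPowerSeries.hasSubst_of_constantCoeff_zero hz)]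
  · congr 1
    ext1 (i | i) <;> rfl
  · rintro (i | i)
    exacts [hx i, hy i]

theorem hasSubst_elim {R : Type*} [CommRing R] {r : ℕ} {x y : Fin r → MvPowerSeries τ R}
    (hx : ∀ i, (x i).constantCoeff = 0) (hy : ∀ i, (y i).constantCoeff = 0) :
    MvPowerSeries.HasSubst (Sum.elim x y) := by
  refine MvPowerSeries.hasSubst_of_constantCoeff_zero ?_
  rintro (i | i)
  exacts [hx i, hy i]

theorem subst_sum {σ ι R S : Type*} [CommRing R] [CommRing S] [Algebra R S]
    {a : σ → MvPowerSeries τ S} (ha : MvPowerSeries.HasSubst a) (s : Finset ι)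
    (f : ι → MvPowerSeries σ R) :
    MvPowerSeries.subst a (∑ i ∈ s, f i) = ∑ i ∈ s, MvPowerSeries.subst a (f i) := by
  simp only [← MvPowerSeries.substAlgHom_apply ha, map_sum]

theorem subst_neg {σ R S : Type*} [CommRing R] [CommRing S] [Algebra R S]
    {a : σ → MvPowerSeries τ S} (ha : MvPowerSeries.HasSubst a)
    (f : MvPowerSeries σ R) :
    MvPowerSeries.subst a (-f) = - MvPowerSeries.subst a f := by
  simp only [← MvPowerSeries.substAlgHom_apply ha, map_neg]

theorem subst_C_algebraMap {σ R S : Type*} [CommRing R] [CommRing S] [Algebra R S]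
    {a : σ → MvPowerSeries τ S} (ha : MvPowerSeries.HasSubst a) (c : R) :
    MvPowerSeries.subst a (MvPowerSeries.C c : MvPowerSeries σ R) = algebraMap R _ c := by
  rw [← MvPowerSeries.substAlgHom_apply ha, MvPowerSeries.c_eq_algebraMap, AlgHom.commutes]

theorem Mould.eval_mul {A R : Type*} [CommRing A] [Algebra ℚ A] [CommRing R] [Algebra A R]
    (Z₁ Z₂ : Mould A) {r : ℕ} (x : Fin r → MvPowerSeries τ R)
    (hx : ∀ i, (x i).constantCoeff = 0) :
    (Z₁.mul Z₂).eval x = ∑ j : Fin (r + 1),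
      Z₁.eval (fun i : Fin j => x ⟨i, by omega⟩) *
        Z₂.eval (fun i : Fin (r - j) => x ⟨j + i, by omega⟩) := by
  have hs := MvPowerSeries.hasSubst_of_constantCoeff_zero hx
  rw [Mould.eval, Mould.mul, subst_sum hs]
  refine Finset.sum_congr rfl fun j _ => ?_
  rw [MvPowerSeries.subst_mul hs, Mould.eval_eval _ _ _ (by simp) hx,
    Mould.eval_eval _ _ _ (by simp) hx]
  simp only [MvPowerSeries.subst_X hs]

theorem Bimould.eval_mul {A A₁ A₂ R : Type*} [CommRing A] [Algebra ℚ A] [CommRing A₁]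
    [Algebra ℚ A₁] [CommRing A₂] [Algebra ℚ A₂] [CommRing R] [Algebra A R] [Algebra A₁ A]
    [Algebra A₂ A] [Algebra A₁ R] [Algebra A₂ R] [IsScalarTower A₁ A R] [IsScalarTower A₂ A R]
    (B : Bimould A₁) (C : Bimould A₂) {r : ℕ} (x y : Fin r → MvPowerSeries τ R)
    (hx : ∀ i, (x i).constantCoeff = 0) (hy : ∀ i, (y i).constantCoeff = 0) :
    (B.mul C : Bimould A).eval x y = ∑ j : Fin (r + 1),
      B.eval (fun i : Fin j => x ⟨i, by omega⟩) (fun i : Fin j => y ⟨i, by omega⟩) *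
        C.eval (fun i : Fin (r - j) => x ⟨j + i, by omega⟩)
          (fun i : Fin (r - j) => y ⟨j + i, by omega⟩) := by
  have hs := hasSubst_elim hx hy
  have hz : ∀ i, (Sum.elim x y i).constantCoeff = 0 := by
    rintro (i | i)
    exacts [hx i, hy i]
  rw [Bimould.eval, Bimould.mul, subst_sum hs]
  refine Finset.sum_congr rfl fun j _ => ?_
  rw [MvPowerSeries.subst_mul hs, Bimould.eval_eval _ _ _ _ (by simp) (by simp) hz,
    Bimould.eval_eval _ _ _ _ (by simp) (by simp) hz]
  simp only [MvPowerSeries.subst_X hs, Sum.elim_inl, Sum.elim_inr]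

section

variable {R : Type*} [CommRing R] [Algebra ℚ R]

theorem Bimould.eval_ofX (Z : Mould ℚ) {r : ℕ} (x y : Fin r → MvPowerSeries τ R)
    (hx : ∀ i, (x i).constantCoeff = 0) (hy : ∀ i, (y i).constantCoeff = 0) :
    (Bimould.ofX Z).eval x y = Z.eval x := by
  have hs := hasSubst_elim hx hy
  have hz : ∀ i, (Sum.elim x y i).constantCoeff = 0 := by
    rintro (i | i)
    exacts [hx i, hy i]
  rw [Bimould.eval, Bimould.ofX, Mould.eval_eval _ _ _ (by simp) hz]
  simp only [MvPowerSeries.subst_X hs, Sum.elim_inl]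

theorem Bimould.eval_ofY (Z : Mould ℚ) {r : ℕ} (x y : Fin r → MvPowerSeries τ R)
    (hx : ∀ i, (x i).constantCoeff = 0) (hy : ∀ i, (y i).constantCoeff = 0) :
    (Bimould.ofY Z).eval x y = Z.eval y := by
  have hs := hasSubst_elim hx hy
  have hz : ∀ i, (Sum.elim x y i).constantCoeff = 0 := by
    rintro (i | i)
    exacts [hx i, hy i]
  rw [Bimould.eval, Bimould.ofY, Mould.eval_eval _ _ _ (by simp) hz]
  simp only [MvPowerSeries.subst_X hs, Sum.elim_inr]

theorem Mould.eval_const (F : PowerSeries ℚ) {r : ℕ} (x : Fin r → MvPowerSeries τ R)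
    (hx : ∀ i, (x i).constantCoeff = 0) :
    (Mould.const F).eval x = algebraMap ℚ _ (PowerSeries.coeff r F) := by
  exact subst_C_algebraMap (MvPowerSeries.hasSubst_of_constantCoeff_zero hx) _

theorem Bimould.eval_const (F : PowerSeries ℚ) {r : ℕ} (x y : Fin r → MvPowerSeries τ R)
    (hx : ∀ i, (x i).constantCoeff = 0) (hy : ∀ i, (y i).constantCoeff = 0) :
    (Bimould.const F).eval x y = algebraMap ℚ _ (PowerSeries.coeff r F) := by
  exact subst_C_algebraMap (hasSubst_elim hx hy) _

theorem Mould.eval_minus (Z : Mould ℚ) {r : ℕ} (x : Fin r → MvPowerSeries τ R)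
    (hx : ∀ i, (x i).constantCoeff = 0) :
    Z.minus.eval x = Z.eval fun i => - x i := by
  have hs := MvPowerSeries.hasSubst_of_constantCoeff_zero hx
  rw [Mould.eval, Mould.minus, Mould.eval_eval _ _ _ (by simp) hx]
  simp only [subst_neg hs, MvPowerSeries.subst_X hs]

theorem Mould.eval_sharp (Z : Mould ℚ) {r : ℕ} (x : Fin r → MvPowerSeries τ R)
    (hx : ∀ i, (x i).constantCoeff = 0) :
    Z.sharp.eval x = Z.eval fun i : Fin r =>
      ∑ j ∈ Finset.univ.filter (fun j : Fin r => (j : ℕ) + i < r), x j := by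
  have hs := MvPowerSeries.hasSubst_of_constantCoeff_zero hx
  rw [Mould.eval, Mould.sharp, Mould.eval_eval _ _ _ (by simp) hx]
  simp only [subst_sum hs, MvPowerSeries.subst_X hs]

end
end CombEis

/-! ### The bimoulds 𝔟 and 𝔟̃ in small depth -/

namespace CombEis

variable {τ : Type*} {R : Type*} [CommRing R] [Algebra ℚ R]

/-- The depth one part of a mould as a power series in one variable. -/
def depthOne (Z : Mould ℚ) : PowerSeries ℚ :=
  PowerSeries.mk fun k => MvPowerSeries.coeff (Finsupp.single 0 k) (Z 1)

/-- Here and below the depth is a variable together with its value: products of moulds produce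
depths of the form `r - j`, which become numerals only after computation, and `rfl` then supplies
the hypothesis. -/
theorem eval_depth_zero {Z : Mould ℚ} (h0 : MvPowerSeries.coeff 0 (Z 0) = 1) {r : ℕ} (hr : r = 0)
    (x : Fin r → MvPowerSeries τ R) : Z.eval x = 1 := by
  subst hr
  have h : Z 0 = MvPowerSeries.C 1 := by
    ext e
    rw [Subsingleton.elim e 0, h0, MvPowerSeries.coeff_zero_C]
  rw [Mould.eval, h, subst_C_algebraMap (MvPowerSeries.hasSubst_of_constantCoeff_zero nofun),
    map_one]

theorem eval_depth_one (Z : Mould ℚ) {r : ℕ} (hr : r = 1)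
    (x : Fin r → MvPowerSeries τ R) (hx : ∀ i, (x i).constantCoeff = 0) :
    Z.eval x = (depthOne Z).subst (x ⟨0, by omega⟩) := by
  subst hr
  have h : Z 1 = (depthOne Z).subst (MvPowerSeries.X 0 : MvPowerSeries (Fin 1) ℚ) := by
    ext e
    have he : e = Finsupp.single 0 (e 0) := by
      refine Finsupp.ext fun i => ?_
      rw [Subsingleton.elim i 0, Finsupp.single_eq_same]
    rw [PowerSeries.coeff_subst_single, if_pos he, depthOne, PowerSeries.coeff_mk, ← he]
  have hs := MvPowerSeries.hasSubst_of_constantCoeff_zero hx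
  rw [Mould.eval, h, PowerSeries.subst, PowerSeries.subst,
    MvPowerSeries.subst_comp_subst_apply (PowerSeries.HasSubst.X 0).const hs]
  simp only [MvPowerSeries.subst_X hs]
  rfl

theorem eval_depth_two (Z : Mould ℚ) {r : ℕ} (hr : r = 2)
    (x : Fin r → MvPowerSeries τ R) :
    Z.eval x = Z.eval ![x ⟨0, by omega⟩, x ⟨1, by omega⟩] := by
  subst hr
  congr 1
  ext1 i
  fin_cases i <;> rfl

/-- The exponent p of Γ starts in degree two, and exp(p) - 1 is a multiple of p. Hence Γ = 1 + γ₂T²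
+ ⋯; the value of γ₂ is never needed, since it cancels in the end. -/
theorem X_sq_dvd_gammaSeries_sub_one (Z : Mould ℚ) :
    PowerSeries.X ^ 2 ∣ Z.gammaSeries - 1 := by
  unfold Mould.gammaSeries
  set p : PowerSeries ℚ := PowerSeries.mk fun n : ℕ =>
      if h : 2 ≤ n then ((-1 : ℚ) ^ n / n) • Z.coeff [⟨n, by omega⟩] else 0 with hp
  have hd : PowerSeries.X ^ 2 ∣ p := by
    rw [PowerSeries.X_pow_dvd_iff]
    intro m hm
    rw [hp, PowerSeries.coeff_mk, dif_neg (by omega)]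
  have hs : PowerSeries.HasSubst p := by
    refine PowerSeries.HasSubst.of_constantCoeff_zero' ?_
    rw [← PowerSeries.coeff_zero_eq_constantCoeff_apply]
    exact PowerSeries.X_pow_dvd_iff.mp hd 0 (by omega)
  obtain ⟨f, hf⟩ : PowerSeries.X ∣ PowerSeries.exp ℚ - 1 := by
    rw [PowerSeries.X_dvd_iff]
    simp
  have h1 : PowerSeries.exp ℚ = PowerSeries.X * f + PowerSeries.C 1 := by
    rw [← hf, map_one]
    ring
  rw [h1, PowerSeries.subst_add hs, PowerSeries.subst_mul hs, PowerSeries.subst_X hs,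
    PowerSeries.subst_C]
  refine hd.trans ⟨f.subst p, ?_⟩
  rw [map_one]
  exact add_sub_cancel_right _ _

theorem coeff_zero_gammaSeries (Z : Mould ℚ) : PowerSeries.coeff 0 Z.gammaSeries = 1 := by
  have h := PowerSeries.X_pow_dvd_iff.mp (X_sq_dvd_gammaSeries_sub_one Z) 0 (by omega)
  rw [map_sub, PowerSeries.coeff_zero_one] at h
  linarith

theorem coeff_one_gammaSeries (Z : Mould ℚ) : PowerSeries.coeff 1 Z.gammaSeries = 0 := by
  have h := PowerSeries.X_pow_dvd_iff.mp (X_sq_dvd_gammaSeries_sub_one Z) 1 (by omega)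
  rw [map_sub, PowerSeries.coeff_one, if_neg one_ne_zero] at h
  linarith

section gam

variable {Z : Mould ℚ} (h0 : MvPowerSeries.coeff 0 (Z 0) = 1)
include h0

theorem gam_eval_zero {r : ℕ} (hr : r = 0) (x : Fin r → MvPowerSeries τ R) :
    Z.gam.eval x = 1 := by
  subst hr
  have hx : ∀ i, (x i).constantCoeff = 0 := nofun
  rw [Mould.gam, Mould.eval_mul _ _ _ hx, Fin.sum_univ_one, Mould.eval_sharp _ _ fun _ => hx _,
    eval_depth_zero h0 rfl, Mould.eval_const _ _ fun _ => hx _]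
  change 1 * algebraMap ℚ _ (PowerSeries.coeff 0 Z.gammaSeries) = _
  rw [coeff_zero_gammaSeries, map_one, mul_one]

theorem gam_eval_one {r : ℕ} (hr : r = 1) (x : Fin r → MvPowerSeries τ R)
    (hx : ∀ i, (x i).constantCoeff = 0) :
    Z.gam.eval x = (depthOne Z).subst (x ⟨0, by omega⟩) := by
  subst hr
  rw [Mould.gam, Mould.eval_mul _ _ _ hx, Fin.sum_univ_two, Mould.eval_sharp _ _ fun _ => hx _,
    Mould.eval_sharp _ _ fun _ => hx _, eval_depth_zero h0 rfl, Mould.eval_const _ _ fun _ => hx _,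
    Mould.eval_const _ _ fun _ => hx _, eval_depth_one Z rfl]
  · change 1 * algebraMap ℚ _ (PowerSeries.coeff 1 Z.gammaSeries) +
      _ * algebraMap ℚ _ (PowerSeries.coeff 0 Z.gammaSeries) = _
    rw [coeff_zero_gammaSeries, coeff_one_gammaSeries, map_one, mul_one, map_zero, mul_zero,
      zero_add]
    congr 1
    exact Fin.sum_univ_one _
  · intro i
    rw [map_sum]
    exact Finset.sum_eq_zero fun _ _ => hx _

theorem gam_eval_two {r : ℕ} (hr : r = 2) (x : Fin r → MvPowerSeries τ R)
    (hx : ∀ i, (x i).constantCoeff = 0) :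
    Z.gam.eval x = Z.eval ![x ⟨0, by omega⟩ + x ⟨1, by omega⟩, x ⟨0, by omega⟩] +
      algebraMap ℚ _ (PowerSeries.coeff 2 Z.gammaSeries) := by
  subst hr
  rw [Mould.gam, Mould.eval_mul _ _ _ hx, Fin.sum_univ_three, Mould.eval_sharp _ _ fun _ => hx _,
    Mould.eval_sharp _ _ fun _ => hx _, Mould.eval_sharp _ _ fun _ => hx _,
    eval_depth_zero h0 rfl, Mould.eval_const _ _ fun _ => hx _,
    Mould.eval_const _ _ fun _ => hx _, Mould.eval_const _ _ fun _ => hx _]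
  change 1 * algebraMap ℚ _ (PowerSeries.coeff 2 Z.gammaSeries) +
      _ * algebraMap ℚ _ (PowerSeries.coeff 1 Z.gammaSeries) +
      _ * algebraMap ℚ _ (PowerSeries.coeff 0 Z.gammaSeries) = _
  rw [coeff_zero_gammaSeries, coeff_one_gammaSeries, map_one, mul_one, map_zero, mul_zero,
      add_zero, one_mul, add_comm, eval_depth_two Z rfl]
  congr 4
  · refine (Finset.sum_filter _ _).trans ((Fin.sum_univ_two _).trans ?_)
    rfl
  · refine (Finset.sum_filter _ _).trans ((Fin.sum_univ_two _).trans ?_)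
    exact add_zero _

end gam

section bimould

theorem coeff_zero_exp_neg_half :
    PowerSeries.coeff 0 (PowerSeries.rescale (-1 / 2 : ℚ) (PowerSeries.exp ℚ)) = 1 := by
  simp

theorem coeff_one_exp_neg_half :
    PowerSeries.coeff 1 (PowerSeries.rescale (-1 / 2 : ℚ) (PowerSeries.exp ℚ)) = -(1 / 2) := by
  rw [PowerSeries.coeff_rescale, PowerSeries.coeff_exp]
  norm_num

variable {Z : Mould ℚ} (h0 : MvPowerSeries.coeff 0 (Z 0) = 1)
include h0

theorem ofMould_eval_zero {r : ℕ} (hr : r = 0) (x y : Fin r → MvPowerSeries τ R) :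
    (Bimould.ofMould Z).eval x y = 1 := by
  subst hr
  have hx : ∀ i, (x i).constantCoeff = 0 := nofun
  have hy : ∀ i, (y i).constantCoeff = 0 := nofun
  rw [Bimould.ofMould, Bimould.eval_mul _ _ _ _ hx hy, Fin.sum_univ_one,
    Bimould.eval_ofY _ _ _ (fun _ => hx _) (fun _ => hy _),
    Bimould.eval_ofX _ _ _ (fun _ => hx _) (fun _ => hy _),
    gam_eval_zero h0 rfl, eval_depth_zero h0 rfl, one_mul]

theorem ofMould_eval_one {r : ℕ} (hr : r = 1) (x y : Fin r → MvPowerSeries τ R)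
    (hx : ∀ i, (x i).constantCoeff = 0) (hy : ∀ i, (y i).constantCoeff = 0) :
    (Bimould.ofMould Z).eval x y = (depthOne Z).subst (x ⟨0, by omega⟩) +
      (depthOne Z).subst (y ⟨0, by omega⟩) := by
  subst hr
  rw [Bimould.ofMould, Bimould.eval_mul _ _ _ _ hx hy, Fin.sum_univ_two]
  simp only [Bimould.eval_ofY _ _ _ (fun _ => hx _) (fun _ => hy _),
    Bimould.eval_ofX _ _ _ (fun _ => hx _) (fun _ => hy _)]
  rw [gam_eval_zero h0 rfl, gam_eval_one h0 rfl, eval_depth_zero h0 rfl,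
    eval_depth_one Z rfl, one_mul, mul_one]
  · rfl
  · exact fun _ => hx _
  · exact fun _ => hy _

theorem ofMould_eval_two {r : ℕ} (hr : r = 2) (x y : Fin r → MvPowerSeries τ R)
    (hx : ∀ i, (x i).constantCoeff = 0) (hy : ∀ i, (y i).constantCoeff = 0) :
    (Bimould.ofMould Z).eval x y = Z.eval ![x ⟨0, by omega⟩, x ⟨1, by omega⟩] +
      (depthOne Z).subst (y ⟨0, by omega⟩) * (depthOne Z).subst (x ⟨1, by omega⟩) +
      (Z.eval ![y ⟨0, by omega⟩ + y ⟨1, by omega⟩, y ⟨0, by omega⟩] +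
      algebraMap ℚ _ (PowerSeries.coeff 2 Z.gammaSeries)) := by
  subst hr
  rw [Bimould.ofMould, Bimould.eval_mul _ _ _ _ hx hy, Fin.sum_univ_three]
  simp only [Bimould.eval_ofY _ _ _ (fun _ => hx _) (fun _ => hy _),
    Bimould.eval_ofX _ _ _ (fun _ => hx _) (fun _ => hy _)]
  rw [gam_eval_zero h0 rfl, gam_eval_one h0 rfl,
    gam_eval_two h0 rfl, eval_depth_zero h0 rfl,
    eval_depth_one Z rfl, one_mul, mul_one, eval_depth_two Z rfl]
  · rfl
  · exact fun _ => hx _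
  · exact fun _ => hy _
  · exact fun _ => hy _

theorem gam_minus_mul_exp_eval_zero {r : ℕ} (hr : r = 0) (x y : Fin r → MvPowerSeries τ R) :
    ((Bimould.ofY Z.gam.minus).mul
      (Bimould.const (PowerSeries.rescale (-1 / 2 : ℚ) (PowerSeries.exp ℚ))) :
        Bimould ℚ).eval x y = 1 := by
  subst hr
  have hx : ∀ i, (x i).constantCoeff = 0 := nofun
  have hy : ∀ i, (y i).constantCoeff = 0 := nofun
  rw [Bimould.eval_mul _ _ _ _ hx hy, Fin.sum_univ_one,
    Bimould.eval_ofY _ _ _ (fun _ => hx _) (fun _ => hy _),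
    Mould.eval_minus _ _ (fun _ => hy _), gam_eval_zero h0 rfl,
    Bimould.eval_const _ _ _ (fun _ => hx _) (fun _ => hy _), one_mul]
  exact (congrArg _ coeff_zero_exp_neg_half).trans (map_one _)

theorem gam_minus_mul_exp_eval_one {r : ℕ} (hr : r = 1) (x y : Fin r → MvPowerSeries τ R)
    (hx : ∀ i, (x i).constantCoeff = 0) (hy : ∀ i, (y i).constantCoeff = 0) :
    ((Bimould.ofY Z.gam.minus).mul
      (Bimould.const (PowerSeries.rescale (-1 / 2 : ℚ) (PowerSeries.exp ℚ))) :
        Bimould ℚ).eval x y = (depthOne Z).subst (-y ⟨0, by omega⟩) - algebraMap ℚ _ (1 / 2) := by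
  subst hr
  have hn : ∀ i, (-y i).constantCoeff = 0 := fun i => by rw [map_neg, hy, neg_zero]
  rw [Bimould.eval_mul _ _ _ _ hx hy, Fin.sum_univ_two]
  simp only [Bimould.eval_ofY _ _ _ (fun _ => hx _) (fun _ => hy _),
    Mould.eval_minus _ _ (fun _ => hy _),
    Bimould.eval_const _ _ _ (fun _ => hx _) (fun _ => hy _)]
  rw [gam_eval_zero h0 rfl, gam_eval_one h0 rfl]
  swap
  · exact fun _ => hn _
  change 1 * algebraMap ℚ _ (PowerSeries.coeff 1 _) +
      (depthOne Z).subst (-y 0) * algebraMap ℚ _ (PowerSeries.coeff 0 _) =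
    (depthOne Z).subst (-y 0) - _
  rw [coeff_zero_exp_neg_half, coeff_one_exp_neg_half, map_one, map_neg]
  ring

theorem bTilde_eval_zero {r : ℕ} (hr : r = 0) (x y : Fin r → MvPowerSeries τ R) :
    (bTilde Z).eval x y = 1 := by
  subst hr
  have hx : ∀ i, (x i).constantCoeff = 0 := nofun
  have hy : ∀ i, (y i).constantCoeff = 0 := nofun
  rw [bTilde, Bimould.eval_mul _ _ _ _ hx hy, Fin.sum_univ_one,
    gam_minus_mul_exp_eval_zero h0 rfl,
    Bimould.eval_ofX _ _ _ (fun _ => hx _) (fun _ => hy _), eval_depth_zero h0 rfl, mul_one]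

/-- The term -1/2 is the linear coefficient of exp(-T/2). It later balances the asymmetry between
1/(e^u-1) and e^u/(e^u-1) in the partial fractions of L_m. -/
theorem bTilde_eval_one {r : ℕ} (hr : r = 1) (x y : Fin r → MvPowerSeries τ R)
    (hx : ∀ i, (x i).constantCoeff = 0) (hy : ∀ i, (y i).constantCoeff = 0) :
    (bTilde Z).eval x y = (depthOne Z).subst (x ⟨0, by omega⟩) +
      (depthOne Z).subst (-y ⟨0, by omega⟩) - algebraMap ℚ _ (1 / 2) := by
  subst hr
  rw [bTilde, Bimould.eval_mul _ _ _ _ hx hy, Fin.sum_univ_two]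
  simp only [Bimould.eval_ofX _ _ _ (fun _ => hx _) (fun _ => hy _)]
  rw [gam_minus_mul_exp_eval_zero h0 rfl, gam_minus_mul_exp_eval_one h0 rfl,
    eval_depth_zero h0 rfl, eval_depth_one Z rfl, one_mul, mul_one, add_sub_assoc]
  · rfl
  · exact fun _ => hx _
  · exact fun _ => hx _
  · exact fun _ => hy _

end bimould

end CombEis

/-! ### Depth two consequences of symmetrility and symmetrality -/

namespace CombEis

theorem coeff_X_mul_eq {σ R : Type*} [CommRing R] (s : σ) (f : MvPowerSeries σ R)
    (e : σ →₀ ℕ) :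
    MvPowerSeries.coeff e (MvPowerSeries.X s * f) =
      if 1 ≤ e s then MvPowerSeries.coeff (e - Finsupp.single s 1) f else 0 := by
  classical
  rw [MvPowerSeries.X, MvPowerSeries.coeff_monomial_mul, one_mul]
  simp only [Finsupp.single_le_iff]

theorem coeff_subst_equiv {σ τ R : Type*} [Finite σ] [CommRing R] (s : σ ≃ τ)
    (f : MvPowerSeries σ R) (e : τ →₀ ℕ) :
    MvPowerSeries.coeff e (MvPowerSeries.subst (fun i => (MvPowerSeries.X (s i) :
      MvPowerSeries τ R)) f) = MvPowerSeries.coeff (e.mapDomain s.symm) f := by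
  have hs : MvPowerSeries.HasSubst fun i => (MvPowerSeries.X (s i) : MvPowerSeries τ R) :=
    MvPowerSeries.hasSubst_of_constantCoeff_zero (by simp)
  have h (d : σ →₀ ℕ) : (d.prod fun i n => (MvPowerSeries.X (s i) : MvPowerSeries τ R) ^ n) =
      MvPowerSeries.monomial (d.mapDomain s) 1 := by
    rw [MvPowerSeries.monomial_one_eq,
      Finsupp.prod_mapDomain_index (fun _ => pow_zero _) (fun _ _ _ => pow_add _ _ _)]
  rw [MvPowerSeries.coeff_subst hs, finsum_eq_single _ (e.mapDomain s.symm)]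
  · rw [h, ← Finsupp.mapDomain_comp, Equiv.self_comp_symm, Finsupp.mapDomain_id,
      MvPowerSeries.coeff_monomial_same, smul_eq_mul, mul_one]
  · intro d hd
    rw [h, MvPowerSeries.coeff_monomial_ne, smul_zero]
    rintro rfl
    apply hd
    rw [← Finsupp.mapDomain_comp, Equiv.symm_comp_self, Finsupp.mapDomain_id]

theorem Mould.coeff_singleton (Z : Mould ℚ) (k : ℕ+) :
    Z.coeff [k] = PowerSeries.coeff ((k : ℕ) - 1) (depthOne Z) := by
  rw [depthOne, PowerSeries.coeff_mk, Mould.coeff]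
  change MvPowerSeries.coeff (_ : Fin 1 →₀ ℕ) (Z 1) = _
  refine congrArg (fun e => MvPowerSeries.coeff e (Z 1)) (Finsupp.ext fun i => ?_)
  obtain rfl : i = (0 : Fin 1) := Subsingleton.elim (α := Fin 1) _ _
  exact (Finsupp.single_eq_same (M := ℕ)).symm

theorem Mould.coeff_pair (Z : Mould ℚ) (e : Fin 2 →₀ ℕ) (k l : ℕ+) (hk : (k : ℕ) - 1 = e 0)
    (hl : (l : ℕ) - 1 = e 1) :
    Z.coeff [k, l] = MvPowerSeries.coeff e (Z 2) := by
  rw [Mould.coeff]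
  change MvPowerSeries.coeff (_ : Fin 2 →₀ ℕ) (Z 2) = _
  refine congrArg (fun e => MvPowerSeries.coeff e (Z 2)) (Finsupp.ext fun i => ?_)
  fin_cases i
  · exact hk
  · exact hl

theorem Mould.coeffMap_single (Z : Mould ℚ) (w : List ℕ+) (x : ℚ) :
    Z.coeffMap (Finsupp.single w x) = x * Z.coeff w := by
  simp [Mould.coeffMap]

theorem Mould.IsDiaSymmetril.coeff_zero {dia : ℕ+ → ℕ+ → (ℕ+ →₀ ℚ)} {Z : Mould ℚ}
    (h : Z.IsDiaSymmetril dia) : MvPowerSeries.coeff 0 (Z 0) = 1 := by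
  have h1 := h.1
  rw [Mould.coeffMap_single, one_mul, Mould.coeff] at h1
  rw [← h1]
  change _ = MvPowerSeries.coeff (_ : Fin 0 →₀ ℕ) (Z 0)
  exact congrArg (fun e => MvPowerSeries.coeff e (Z 0)) (Subsingleton.elim _ _)

theorem Mould.IsDiaSymmetril.coeff_mul_coeff {dia : ℕ+ → ℕ+ → (ℕ+ →₀ ℚ)} {Z : Mould ℚ}
    (h : Z.IsDiaSymmetril dia) (k l : ℕ+) :
    Z.coeff [k] * Z.coeff [l] = Z.coeff [k, l] + Z.coeff [l, k] +
      (dia k l).sum fun c x => x * Z.coeff [c] := by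
  have h1 := h.2 (Finsupp.single [k] 1) (Finsupp.single [l] 1)
  rw [qsh, Finsupp.sum_single_index (by simp), Finsupp.sum_single_index (by simp),
    Mould.coeffMap_single, Mould.coeffMap_single] at h1
  simp only [one_mul, one_smul, qshWord, consLetter, Finsupp.mapDomain_single, map_add,
    Mould.coeffMap_single, Finsupp.smul_single, smul_eq_mul, mul_one] at h1
  rw [← h1, map_finsuppSum]
  simp only [Mould.coeffMap_single]

theorem coeff_swap (f : MvPowerSeries (Fin 2) ℚ) (e : Fin 2 →₀ ℕ) :
    MvPowerSeries.coeff e (MvPowerSeries.subst ![(MvPowerSeries.X 1 : MvPowerSeries (Fin 2) ℚ),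
      MvPowerSeries.X 0] f) = MvPowerSeries.coeff (e.mapDomain (Equiv.swap 0 1)) f := by
  rw [← Equiv.symm_swap, ← coeff_subst_equiv]
  congr 2
  ext1 i
  fin_cases i <;> rfl

/-- The homomorphism property on two one-letter words, collected over all pairs of letters; `D` is
the generating series of the ⋄-terms. The exponent e belongs to the letter of index e + 1, whence
`succPNat`. -/
theorem Mould.IsDiaSymmetril.depthOne_mul {dia : ℕ+ → ℕ+ → (ℕ+ →₀ ℚ)} {Z : Mould ℚ}
    (h : Z.IsDiaSymmetril dia) (D : MvPowerSeries (Fin 2) ℚ)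
    (hD : ∀ e, MvPowerSeries.coeff e D = (dia (e 0).succPNat (e 1).succPNat).sum
      fun c x => x * PowerSeries.coeff ((c : ℕ) - 1) (depthOne Z)) :
    (depthOne Z).subst (MvPowerSeries.X 0 : MvPowerSeries (Fin 2) ℚ) *
      (depthOne Z).subst (MvPowerSeries.X 1 : MvPowerSeries (Fin 2) ℚ) =
      Z.eval ![(MvPowerSeries.X 0 : MvPowerSeries (Fin 2) ℚ), MvPowerSeries.X 1] +
        Z.eval ![(MvPowerSeries.X 1 : MvPowerSeries (Fin 2) ℚ), MvPowerSeries.X 0] + D := by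
  have hid : Z.eval ![(MvPowerSeries.X 0 : MvPowerSeries (Fin 2) ℚ), MvPowerSeries.X 1] = Z 2 := by
    have : ![(MvPowerSeries.X 0 : MvPowerSeries (Fin 2) ℚ), MvPowerSeries.X 1] =
        MvPowerSeries.X := by
      ext1 i
      fin_cases i <;> rfl
    rw [Mould.eval, this, MvPowerSeries.subst_self, id]
  ext e
  have h1 := h.coeff_mul_coeff (e 0).succPNat (e 1).succPNat
  rw [Z.coeff_pair e (e 0).succPNat (e 1).succPNat (by simp) (by simp),
    Z.coeff_pair (e.mapDomain (Equiv.swap 0 1)) (e 1).succPNat (e 0).succPNat] at h1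
  · rw [PowerSeries.coeff_subst_X_zero_subst_mul_X_one, map_add, map_add, hid, Mould.eval,
      coeff_swap, hD]
    simpa only [Mould.coeff_singleton, Nat.succPNat_coe, Nat.succ_sub_one] using h1
  · rw [Finsupp.mapDomain_equiv_apply]
    simp
  · rw [Finsupp.mapDomain_equiv_apply]
    simp

section eval

variable {τ : Type*} {R : Type*} [CommRing R] [Algebra ℚ R]

omit [Algebra ℚ R] in
theorem hasSubst_pair {x y : MvPowerSeries τ R} (hx : x.constantCoeff = 0)
    (hy : y.constantCoeff = 0) : MvPowerSeries.HasSubst ![x, y] := by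
  refine MvPowerSeries.hasSubst_of_constantCoeff_zero fun i => ?_
  fin_cases i
  exacts [hx, hy]

theorem subst_pair_eval (Z : Mould ℚ) {x y : MvPowerSeries τ R} (hx : x.constantCoeff = 0)
    (hy : y.constantCoeff = 0) (i j : Fin 2) :
    MvPowerSeries.subst ![x, y]
      (Z.eval ![(MvPowerSeries.X i : MvPowerSeries (Fin 2) ℚ), MvPowerSeries.X j]) =
      Z.eval ![![x, y] i, ![x, y] j] := by
  have hs := hasSubst_pair hx hy
  rw [Mould.eval_eval]
  · congr 1
    ext1 k
    fin_cases k <;> exact MvPowerSeries.subst_X hs _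
  · intro k
    fin_cases k <;> simp
  · intro k
    fin_cases k
    exacts [hx, hy]

theorem subst_comp_subst {υ S : Type*} [Finite υ] [CommRing S] [Algebra ℚ S] [Algebra R S]
    [IsScalarTower ℚ R S] (f : PowerSeries ℚ) {x : MvPowerSeries υ R} (hx : x.constantCoeff = 0)
    {a : υ → MvPowerSeries τ S} (ha : ∀ i, (a i).constantCoeff = 0) :
    MvPowerSeries.subst a (f.subst x) = f.subst (MvPowerSeries.subst a x) :=
  MvPowerSeries.subst_comp_subst_apply
    (PowerSeries.HasSubst.of_constantCoeff_zero hx).const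
    (MvPowerSeries.hasSubst_of_constantCoeff_zero ha) f

theorem subst_pair_subst (f : PowerSeries ℚ) {x y : MvPowerSeries τ R} (hx : x.constantCoeff = 0)
    (hy : y.constantCoeff = 0) (i : Fin 2) :
    MvPowerSeries.subst ![x, y] (f.subst (MvPowerSeries.X i : MvPowerSeries (Fin 2) ℚ)) =
      f.subst (![x, y] i) := by
  rw [subst_comp_subst f (by simp), MvPowerSeries.subst_X (hasSubst_pair hx hy)]
  intro k
  fin_cases k
  exacts [hx, hy]

/-- The ⋄-terms vanish. The identity in two independent variables is transported to `x`, `y` by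
substitution. -/
theorem Mould.IsSymmetral.depthOne_mul {Z : Mould ℚ} (h : Z.IsSymmetral) {x y : MvPowerSeries τ R}
    (hx : x.constantCoeff = 0) (hy : y.constantCoeff = 0) :
    (depthOne Z).subst x * (depthOne Z).subst y = Z.eval ![x, y] + Z.eval ![y, x] := by
  have hs := hasSubst_pair hx hy
  have h1 := congrArg (MvPowerSeries.subst ![x, y])
    (Mould.IsDiaSymmetril.depthOne_mul h 0 fun e => by simp [shuffleDia])
  rw [add_zero, MvPowerSeries.subst_mul hs, MvPowerSeries.subst_add hs, subst_pair_eval Z hx hy,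
    subst_pair_eval Z hx hy, subst_pair_subst _ hx hy, subst_pair_subst _ hx hy] at h1
  exact h1

/-- The coefficients of the second factor depend only on the total degree, so the product with X₀ -
X₁ telescopes and only pure powers of one variable survive. -/
theorem X_sub_X_mul_divDiff (f : PowerSeries ℚ) :
    ((MvPowerSeries.X 0 : MvPowerSeries (Fin 2) ℚ) - MvPowerSeries.X 1) *
      (show MvPowerSeries (Fin 2) ℚ from fun e => PowerSeries.coeff (e 0 + e 1 + 1) f) =
      f.subst (MvPowerSeries.X 0 : MvPowerSeries (Fin 2) ℚ) -
        f.subst (MvPowerSeries.X 1 : MvPowerSeries (Fin 2) ℚ) := by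
  ext e
  rw [sub_mul, map_sub, map_sub, coeff_X_mul_eq, coeff_X_mul_eq, PowerSeries.coeff_subst_single,
    PowerSeries.coeff_subst_single, MvPowerSeries.coeff_apply, MvPowerSeries.coeff_apply]
  have h0 : e = Finsupp.single 0 (e 0) ↔ e 1 = 0 := by
    rw [Finsupp.ext_iff, Fin.forall_fin_two]
    simp
  have h1 : e = Finsupp.single 1 (e 1) ↔ e 0 = 0 := by
    rw [Finsupp.ext_iff, Fin.forall_fin_two]
    simp
  simp only [h0, h1, Finsupp.tsub_apply, Finsupp.single_apply]
  by_cases a : e 0 = 0 <;> by_cases b : e 1 = 0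
  · simp [a, b]
  · have : e 1 - 1 + 1 = e 1 := by omega
    simp [a, b, this, Nat.one_le_iff_ne_zero]
  · have : e 0 - 1 + 1 = e 0 := by omega
    simp [a, b, this, Nat.one_le_iff_ne_zero]
  · have : e 0 - 1 + e 1 + 1 = e 0 + (e 1 - 1) + 1 := by omega
    simp [a, b, this, Nat.one_le_iff_ne_zero]

/-- For z_k ⋄ z_l = z_{k+l} the ⋄-terms form a divided difference of the depth one part. Multiplying
by `x - y` avoids a division that need not make sense after substitution. -/
theorem Mould.IsSymmetril.depthOne_mul {Z : Mould ℚ} (h : Z.IsSymmetril) {x y : MvPowerSeries τ R}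
    (hx : x.constantCoeff = 0) (hy : y.constantCoeff = 0) :
    (x - y) * ((depthOne Z).subst x * (depthOne Z).subst y - Z.eval ![x, y] - Z.eval ![y, x]) =
      (depthOne Z).subst x - (depthOne Z).subst y := by
  have hs := hasSubst_pair hx hy
  have h1 := Mould.IsDiaSymmetril.depthOne_mul h
    (show MvPowerSeries (Fin 2) ℚ from fun e => PowerSeries.coeff (e 0 + e 1 + 1) (depthOne Z))
    fun e => by
      rw [stuffleDia, Finsupp.sum_single_index (by simp), one_mul, MvPowerSeries.coeff_apply]
      congr 2
      simp
      omega
  have h2 := congrArg (MvPowerSeries.subst ![x, y]) (X_sub_X_mul_divDiff (depthOne Z))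
  rw [← sub_eq_iff_eq_add', ← sub_sub] at h1
  rw [← h1, MvPowerSeries.subst_mul hs, MvPowerSeries.subst_sub hs, MvPowerSeries.subst_sub hs,
    MvPowerSeries.subst_sub hs, MvPowerSeries.subst_sub hs,
    MvPowerSeries.subst_mul hs, subst_pair_eval Z hx hy,
    subst_pair_eval Z hx hy, subst_pair_subst _ hx hy, subst_pair_subst _ hx hy,
    MvPowerSeries.subst_X hs, MvPowerSeries.subst_X hs] at h2
  exact h2

theorem exp_subst_add {x y : MvPowerSeries τ R} (hx : x.constantCoeff = 0)
    (hy : y.constantCoeff = 0) :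
    (PowerSeries.exp ℚ).subst (x + y) =
      (PowerSeries.exp ℚ).subst x * (PowerSeries.exp ℚ).subst y := by
  have h : (PowerSeries.exp ℚ).subst (MvPowerSeries.X 0 + MvPowerSeries.X 1 :
      MvPowerSeries (Fin 2) ℚ) = (PowerSeries.exp ℚ).subst (MvPowerSeries.X 0 :
        MvPowerSeries (Fin 2) ℚ) *
      (PowerSeries.exp ℚ).subst (MvPowerSeries.X 1 : MvPowerSeries (Fin 2) ℚ) := by
    ext e
    rw [PowerSeries.coeff_subst_X_zero_add_X_one, PowerSeries.coeff_subst_X_zero_subst_mul_X_one]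
    simp only [PowerSeries.coeff_exp, Algebra.algebraMap_self, RingHom.id_apply]
    rw [Nat.cast_choose ℚ (Nat.le_add_right _ _), Nat.add_sub_cancel_left]
    have := Nat.factorial_ne_zero (e 0 + e 1)
    field_simp
  have hs := hasSubst_pair hx hy
  have h2 := congrArg (MvPowerSeries.subst ![x, y]) h
  rw [MvPowerSeries.subst_mul hs, subst_pair_subst _ hx hy, subst_pair_subst _ hx hy,
    subst_comp_subst _ (by simp), MvPowerSeries.subst_add hs, MvPowerSeries.subst_X hs,
    MvPowerSeries.subst_X hs] at h2
  · exact h2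
  · intro i
    fin_cases i
    exacts [hx, hy]

end eval

/-! ### The Bernoulli depth one part of the rational solution -/

section rational

variable {β : Mould ℚ} (hβ : IsRationalSolution β)
include hβ

theorem IsRationalSolution.coeff_zero : MvPowerSeries.coeff 0 (β 0) = 1 :=
  Mould.IsDiaSymmetril.coeff_zero hβ.eds.1

theorem IsRationalSolution.coeff_depthOne (n : ℕ) : PowerSeries.coeff n (depthOne β) =
    if n = 0 then 0 else -bernoulli (n + 1) / (2 * ((n + 1).factorial : ℚ)) := by
  have h := hβ.depth_one n.succPNat
  rw [Mould.coeff_singleton] at h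
  have e : n.succPNat = 1 ↔ n = 0 := by
    rw [← PNat.coe_inj]
    simp
  simpa [e] using h

/-- This is 2β(X) = 1/X - 1/2 - 1/(e^X-1) cleared of denominators, a consequence of ∑ B_k X^k/k! =
X/(e^X-1). -/
theorem IsRationalSolution.depthOne_exp :
    2 * PowerSeries.X * (PowerSeries.exp ℚ - 1) * depthOne β =
      -(PowerSeries.X - (PowerSeries.exp ℚ - 1) +
        PowerSeries.C (1 / 2) * PowerSeries.X * (PowerSeries.exp ℚ - 1)) := by
  -- Subtracting 1 and adding X/2 removes the terms k = 0 and k = 1 of the Bernoulli series, as B₁ =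
  -- -1/2.
  have h : 2 * (PowerSeries.X * depthOne β) =
      -(bernoulliPowerSeries ℚ - 1 + PowerSeries.C (1 / 2) * PowerSeries.X) := by
    rw [← map_ofNat (PowerSeries.C (R := ℚ)) 2]
    ext n
    rw [PowerSeries.coeff_C_mul, map_neg, map_add, map_sub, PowerSeries.coeff_C_mul,
      PowerSeries.coeff_one, PowerSeries.coeff_X, bernoulliPowerSeries, PowerSeries.coeff_mk]
    rcases n with _ | _ | n
    · simp
    · rw [PowerSeries.coeff_succ_X_mul, hβ.coeff_depthOne]
      norm_num
    · rw [PowerSeries.coeff_succ_X_mul, hβ.coeff_depthOne]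
      simp
      field_simp
  linear_combination (PowerSeries.exp ℚ - 1) * h - bernoulliPowerSeries_mul_exp_sub_one ℚ

variable {τ : Type*} {R : Type*} [CommRing R] [Algebra ℚ R]

theorem IsRationalSolution.depthOne_subst_exp {x : MvPowerSeries τ R} (hx : x.constantCoeff = 0) :
    2 * x * ((PowerSeries.exp ℚ).subst x - 1) * (depthOne β).subst x =
      -(x - ((PowerSeries.exp ℚ).subst x - 1) +
        algebraMap ℚ _ (1 / 2) * x * ((PowerSeries.exp ℚ).subst x - 1)) := by
  have hs := PowerSeries.HasSubst.of_constantCoeff_zero hx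
  have h := congrArg (PowerSeries.substAlgHom hs) hβ.depthOne_exp
  simp only [map_mul, map_sub, map_add, map_neg, map_one, map_ofNat] at h
  have hC : PowerSeries.substAlgHom hs (PowerSeries.C (1 / 2 : ℚ)) = algebraMap ℚ _ (1 / 2) :=
    AlgHom.commutes (PowerSeries.substAlgHom hs) _
  rw [hC, PowerSeries.substAlgHom_X hs] at h
  simpa only [PowerSeries.coe_substAlgHom] using h

/-- The numbers B_k vanish for odd k ≥ 3 and k = 1 is left out of β, so only odd powers of X occur.
-/
theorem IsRationalSolution.depthOne_subst_neg {x : MvPowerSeries τ R} (hx : x.constantCoeff = 0) :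
    (depthOne β).subst (-x) = -(depthOne β).subst x := by
  have h : (depthOne β).subst (-PowerSeries.X : PowerSeries ℚ) = -depthOne β := by
    have : (-PowerSeries.X : PowerSeries ℚ) = (-1 : ℚ) • PowerSeries.X := by simp
    rw [this, ← PowerSeries.rescale_eq_subst]
    ext n
    rw [PowerSeries.coeff_rescale, map_neg, hβ.coeff_depthOne]
    rcases Nat.even_or_odd n with hn | hn
    · split_ifs with h0
      · simp
      · rw [bernoulli_eq_zero_of_odd hn.add_one (by omega)]
        simp
    · rw [hn.neg_one_pow, neg_one_mul]
  have hs := PowerSeries.HasSubst.of_constantCoeff_zero hx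
  have h2 := congrArg (PowerSeries.subst x) h
  rw [PowerSeries.subst_comp_subst_apply (by
    exact PowerSeries.HasSubst.of_constantCoeff_zero' (by simp)) hs] at h2
  have e (f : PowerSeries ℚ) : PowerSeries.subst x (-f) = -PowerSeries.subst x f := by
    rw [← PowerSeries.coe_substAlgHom hs, map_neg]
  rw [e, e, PowerSeries.subst_X hs] at h2
  exact h2

/-- Γ has no linear term. This is needed because symmetrality of β_γ is a statement about the depth
one part of β_γ rather than that of β. -/
theorem IsRationalSolution.depthOne_gam : depthOne β.gam = depthOne β := by
  have h : (depthOne β.gam).subst (MvPowerSeries.X 0 : MvPowerSeries (Fin 1) ℚ) =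
      (depthOne β).subst (MvPowerSeries.X 0 : MvPowerSeries (Fin 1) ℚ) := by
    have h1 := gam_eval_one hβ.coeff_zero rfl
      (fun _ : Fin 1 => (MvPowerSeries.X 0 : MvPowerSeries (Fin 1) ℚ)) (by simp)
    rwa [eval_depth_one _ rfl _ (by simp)] at h1
  ext n
  have h2 := congrArg (MvPowerSeries.coeff (Finsupp.single 0 n)) h
  rwa [PowerSeries.coeff_subst_single, PowerSeries.coeff_subst_single, Finsupp.single_eq_same,
    if_pos rfl, if_pos rfl] at h2

/-- Symmetrality of β_γ with ♯ and Γ unfolded; each of the two orderings contributes one γ₂. -/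
theorem IsRationalSolution.depthOne_mul_eq_gam {x y : MvPowerSeries τ R}
    (hx : x.constantCoeff = 0) (hy : y.constantCoeff = 0) :
    (depthOne β).subst x * (depthOne β).subst y =
      β.eval ![x + y, x] + β.eval ![y + x, y] +
        2 * algebraMap ℚ _ (PowerSeries.coeff 2 β.gammaSeries) := by
  have h := hβ.eds.2.depthOne_mul hx hy
  rw [hβ.depthOne_gam, gam_eval_two hβ.coeff_zero rfl, gam_eval_two hβ.coeff_zero rfl] at h
  · rw [h]
    change β.eval ![x + y, x] + _ + (β.eval ![y + x, y] + _) = _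
    ring
  · intro i
    fin_cases i
    exacts [hy, hx]
  · intro i
    fin_cases i
    exacts [hx, hy]

end rational

end CombEis

/-! ### Reduction modulo powers of q and the series L_m -/

namespace CombEis

variable {τ : Type*}

/-- Power series over `ℚ⟦q⟧` modulo `q^{N+1}`. -/
def ModQ (τ : Type*) (N : ℕ) : Type _ :=
  MvPowerSeries τ QSer ⧸ Ideal.span {qPow τ (N + 1)}

instance (τ : Type*) (N : ℕ) : CommRing (ModQ τ N) :=
  inferInstanceAs (CommRing (MvPowerSeries τ QSer ⧸ Ideal.span {qPow τ (N + 1)}))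

/-- Reduction modulo `q^{N+1}`. -/
def modq (τ : Type*) (N : ℕ) : MvPowerSeries τ QSer →+* ModQ τ N :=
  Ideal.Quotient.mk _

theorem modq_eq_modq {N : ℕ} {f g : MvPowerSeries τ QSer} :
    modq τ N f = modq τ N g ↔ qPow τ (N + 1) ∣ f - g := by
  rw [← Ideal.mem_span_singleton]
  exact Ideal.Quotient.mk_eq_mk_iff_sub_mem f g

theorem qPow_dvd_iff {n : ℕ} {f : MvPowerSeries τ QSer} :
    qPow τ n ∣ f ↔ ∀ e, ∀ k < n, PowerSeries.coeff k (MvPowerSeries.coeff e f) = 0 := by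
  simp only [← PowerSeries.X_pow_dvd_iff]
  constructor
  · rintro ⟨g, rfl⟩ e
    rw [qPow, MvPowerSeries.coeff_C_mul]
    exact Dvd.intro _ rfl
  · intro h
    choose g hg using h
    refine ⟨(show MvPowerSeries τ QSer from g), ?_⟩
    ext1 e
    rw [hg, qPow, MvPowerSeries.coeff_C_mul]
    rfl

theorem modq_eq_modq_iff_coeff {N : ℕ} {f g : MvPowerSeries τ QSer} :
    modq τ N f = modq τ N g ↔ ∀ e, ∀ k ≤ N, PowerSeries.coeff k (MvPowerSeries.coeff e f) =
      PowerSeries.coeff k (MvPowerSeries.coeff e g) := by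
  simp only [modq_eq_modq, qPow_dvd_iff, map_sub, sub_eq_zero, Nat.lt_succ_iff]

/-- The coefficient of q^n is visible modulo q^{n+1}. This lets finite truncations replace the
infinite sums over m. -/
theorem eq_of_modq {f g : MvPowerSeries τ QSer} (h : ∀ N, modq τ N f = modq τ N g) : f = g := by
  ext e n
  exact modq_eq_modq_iff_coeff.mp (h n) e n le_rfl

theorem modq_qPow {N n : ℕ} (h : N < n) : modq τ N (qPow τ n) = 0 := by
  rw [← map_zero (modq τ N), modq_eq_modq_iff_coeff]
  intro e k hk
  have := qPow_dvd_iff.mp (dvd_refl (qPow τ n)) e k (by omega)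
  simp [this]

theorem subst_qPow {σ : Type*} {a : σ → MvPowerSeries τ QSer} (n : ℕ) :
    MvPowerSeries.subst a (qPow σ n) = qPow τ n :=
  MvPowerSeries.subst_C _

theorem modq_subst {σ : Type*} {a : σ → MvPowerSeries τ QSer} (ha : MvPowerSeries.HasSubst a)
    {N : ℕ} {f g : MvPowerSeries σ QSer} (h : modq σ N f = modq σ N g) :
    modq τ N (MvPowerSeries.subst a f) = modq τ N (MvPowerSeries.subst a g) := by
  rw [modq_eq_modq] at h ⊢
  obtain ⟨c, hc⟩ := h
  refine ⟨MvPowerSeries.subst a c, ?_⟩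
  rw [← MvPowerSeries.subst_sub ha, hc, MvPowerSeries.subst_mul ha, subst_qPow]

theorem qPow_add (m n : ℕ) : qPow τ (m + n) = qPow τ m * qPow τ n := by
  rw [qPow, pow_add, map_mul, qPow, qPow]

theorem qPow_mul (m n : ℕ) : qPow τ (m * n) = qPow τ m ^ n := by
  rw [qPow, pow_mul, map_pow, qPow]

theorem mvExp_add {x y : MvPowerSeries τ QSer} (hx : x.constantCoeff = 0)
    (hy : y.constantCoeff = 0) : mvExp (x + y) = mvExp x * mvExp y :=
  exp_subst_add hx hy

theorem mvExp_zero : mvExp (0 : MvPowerSeries τ QSer) = 1 := by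
  rw [mvExp, PowerSeries.subst_zero_eq_C_constantCoeff]
  simp

theorem mvExp_nsmul {x : MvPowerSeries τ QSer} (hx : x.constantCoeff = 0) (n : ℕ) :
    mvExp (n • x) = mvExp x ^ n := by
  induction n with
  | zero => rw [zero_smul, mvExp_zero, pow_zero]
  | succ n ih =>
    rw [succ_nsmul, mvExp_add (by rw [map_nsmul, hx, smul_zero]) hx, ih, pow_succ]

theorem mul_Lser {m : ℕ} (hm : 1 ≤ m) (x y : MvPowerSeries τ QSer) :
    (1 - mvExp x * qPow τ m) * Lser m x y = mvExp (x + m • y) * qPow τ m := by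
  rw [Lser, mul_left_comm, Ring.mul_inverse_cancel _ (isUnit_denominator hm x), mul_one]

theorem subst_mvExp {σ : Type*} [Finite σ] {a : σ → MvPowerSeries τ QSer}
    (ha : ∀ i, (a i).constantCoeff = 0) {x : MvPowerSeries σ QSer} (hx : x.constantCoeff = 0) :
    MvPowerSeries.subst a (mvExp x) = mvExp (MvPowerSeries.subst a x) :=
  subst_comp_subst _ hx ha

theorem subst_nsmul {σ R S : Type*} [CommRing R] [CommRing S] [Algebra R S]
    {a : σ → MvPowerSeries τ S} (ha : MvPowerSeries.HasSubst a) (n : ℕ)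
    (f : MvPowerSeries σ R) :
    MvPowerSeries.subst a (n • f) = n • MvPowerSeries.subst a f := by
  simp only [← MvPowerSeries.substAlgHom_apply ha, map_nsmul]

theorem subst_Lser {σ : Type*} [Finite σ] {a : σ → MvPowerSeries τ QSer}
    (ha : ∀ i, (a i).constantCoeff = 0) {x y : MvPowerSeries σ QSer} (hx : x.constantCoeff = 0)
    (hy : y.constantCoeff = 0) {m : ℕ} (hm : 1 ≤ m) :
    MvPowerSeries.subst a (Lser m x y) =
      Lser m (MvPowerSeries.subst a x) (MvPowerSeries.subst a y) := by
  have hs := MvPowerSeries.hasSubst_of_constantCoeff_zero ha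
  refine (isUnit_denominator hm (MvPowerSeries.subst a x)).mul_left_cancel ?_
  rw [mul_Lser hm]
  have h := congrArg (MvPowerSeries.substAlgHom hs) (mul_Lser hm x y)
  simp only [map_mul, map_sub, map_one] at h
  simp only [MvPowerSeries.substAlgHom_apply, subst_qPow, subst_mvExp ha hx] at h
  rw [h, subst_mvExp ha (by simp [hx, hy]), MvPowerSeries.subst_add hs, subst_nsmul hs]

/-- The geometric series for 1/(1 - e^x q^m), whose terms beyond n = N are divisible by q^{N+1}. -/
theorem modq_Lser {m : ℕ} (hm : 1 ≤ m) (N : ℕ) {x y : MvPowerSeries τ QSer}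
    (hx : x.constantCoeff = 0) (hy : y.constantCoeff = 0) :
    modq τ N (Lser m x y) =
      ∑ n ∈ Finset.Icc 1 N, modq τ N (mvExp (n • x + m • y) * qPow τ (m * n)) := by
  rw [← map_sum]
  have hy' : (m • y).constantCoeff = 0 := by rw [map_nsmul, hy, smul_zero]
  set A := mvExp x * qPow τ m with hA
  have hsum : ∑ n ∈ Finset.Icc 1 N, mvExp (n • x + m • y) * qPow τ (m * n) =
      mvExp (m • y) * A * ∑ n ∈ Finset.range N, A ^ n := by
    rw [Finset.mul_sum]
    refine Finset.sum_nbij' (fun n => n - 1) (fun n => n + 1) ?_ ?_ ?_ ?_ ?_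
    · simp
      omega
    · simp
    · simp
      omega
    · simp
    · intro n hn
      obtain ⟨k, rfl⟩ := Nat.exists_eq_add_of_le' (Finset.mem_Icc.mp hn).1
      rw [Nat.add_sub_cancel, mvExp_add (by simp [hx]) hy', mvExp_nsmul hx, hA, qPow_mul]
      ring
  have hu : IsUnit (modq τ N (1 - A)) := (isUnit_denominator hm x).map _
  refine hu.mul_left_cancel ?_
  rw [← map_mul, ← map_mul, mul_Lser hm, hsum, mvExp_add hx hy']
  have hg : (1 - A) * ∑ n ∈ Finset.range N, A ^ n = 1 - A ^ N := mul_neg_geom_sum A N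
  -- Since m ≥ 1, the exponent m(N+1) of q exceeds N.
  have h0 : modq τ N (A ^ (N + 1)) = 0 := by
    rw [hA, mul_pow, ← qPow_mul, map_mul, modq_qPow, mul_zero]
    nlinarith
  have : (1 - A) * (mvExp (m • y) * A * ∑ n ∈ Finset.range N, A ^ n) =
      mvExp (m • y) * A - mvExp (m • y) * A ^ (N + 1) := by
    linear_combination mvExp (m • y) * A * hg
  rw [this, map_sub, map_mul _ _ (A ^ (N + 1)), h0, mul_zero, sub_zero]
  congr 1
  ring

/-! ### Truncated sums of L_m and their swap symmetries -/

/-- The truncation of the depth one part of `𝔤^∗` to `m ≤ N`. -/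
def gTrunc (N : ℕ) (x y : MvPowerSeries τ QSer) : MvPowerSeries τ QSer :=
  ∑ m ∈ Finset.Icc 1 N, Lser m x y

/-- The truncation to `N ≥ m₁ > m₂` of the contribution `∑ L_{m₁} L_{m₂}` to `𝔤^∗`. -/
def ggTrunc (N : ℕ) (x₁ x₂ y₁ y₂ : MvPowerSeries τ QSer) : MvPowerSeries τ QSer :=
  ∑ p ∈ Finset.Icc 1 N ×ˢ Finset.Icc 1 N with p.2 < p.1, Lser p.1 x₁ y₁ * Lser p.2 x₂ y₂

theorem sum_sum_eq_sum_lt_add_sum_lt_add_sum {M : Type*} [AddCommMonoid M] (s : Finset ℕ)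
    (f : ℕ → ℕ → M) :
    ∑ m ∈ s, ∑ n ∈ s, f m n = ∑ p ∈ s ×ˢ s with p.2 < p.1, f p.1 p.2 +
      ∑ p ∈ s ×ˢ s with p.2 < p.1, f p.2 p.1 + ∑ m ∈ s, f m m := by
  rw [← Finset.sum_product', ← Finset.sum_filter_add_sum_filter_not _ (fun p : ℕ × ℕ => p.2 < p.1),
    add_assoc]
  congr 1
  rw [← Finset.sum_filter_add_sum_filter_not _ (fun p : ℕ × ℕ => p.1 < p.2)]
  congr 1
  · refine Finset.sum_nbij' Prod.swap Prod.swap ?_ ?_ ?_ ?_ ?_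
    · rintro ⟨a, b⟩
      simp
      grind
    · rintro ⟨a, b⟩
      simp
      grind
    · simp
    · simp
    · intro p _
      rfl
  · refine Finset.sum_nbij' Prod.fst (fun m => (m, m)) ?_ ?_ ?_ ?_ ?_
    · simp
      grind
    · simp
    · rintro ⟨a, b⟩
      simp
      omega
    · simp
    · rintro ⟨a, b⟩
      simp
      intro _ _ h1 h2
      obtain rfl : a = b := by omega
      rfl

theorem gTrunc_mul_gTrunc (N : ℕ) (x₁ x₂ y₁ y₂ : MvPowerSeries τ QSer) :
    gTrunc N x₁ y₁ * gTrunc N x₂ y₂ = ggTrunc N x₁ x₂ y₁ y₂ + ggTrunc N x₂ x₁ y₂ y₁ +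
      ∑ m ∈ Finset.Icc 1 N, Lser m x₁ y₁ * Lser m x₂ y₂ := by
  rw [gTrunc, gTrunc, Finset.sum_mul_sum, sum_sum_eq_sum_lt_add_sum_lt_add_sum, ggTrunc, ggTrunc]
  simp only [mul_comm (Lser _ x₁ y₁)]

/-- Exchange m and n in the double sum of e^{nx+my}q^{mn}. -/
theorem modq_gTrunc_symm (N : ℕ) {x y : MvPowerSeries τ QSer}
    (hx : x.constantCoeff = 0) (hy : y.constantCoeff = 0) :
    modq τ N (gTrunc N x y) = modq τ N (gTrunc N y x) := by
  rw [gTrunc, gTrunc, map_sum, map_sum]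
  rw [Finset.sum_congr rfl fun m hm => modq_Lser (Finset.mem_Icc.mp hm).1 N hx hy,
    Finset.sum_congr rfl fun m hm => modq_Lser (Finset.mem_Icc.mp hm).1 N hy hx, Finset.sum_comm]
  refine Finset.sum_congr rfl fun n _ => Finset.sum_congr rfl fun m _ => ?_
  rw [add_comm, mul_comm n m]

/-- Terms with m₁n₁ + m₂n₂ > N vanish modulo q^{N+1}. Recording this bound makes the index set
stable under the reindexing in `modq_ggTrunc_swap`; the separate bounds by N alone would not be. -/
theorem modq_ggTrunc (N : ℕ) {x₁ x₂ y₁ y₂ : MvPowerSeries τ QSer} (hx₁ : x₁.constantCoeff = 0)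
    (hx₂ : x₂.constantCoeff = 0) (hy₁ : y₁.constantCoeff = 0) (hy₂ : y₂.constantCoeff = 0) :
    modq τ N (ggTrunc N x₁ x₂ y₁ y₂) =
      ∑ p ∈ (Finset.Icc 1 N ×ˢ Finset.Icc 1 N) ×ˢ (Finset.Icc 1 N ×ˢ Finset.Icc 1 N) with
        p.1.2 < p.1.1 ∧ p.1.1 * p.2.1 + p.1.2 * p.2.2 ≤ N,
        modq τ N (mvExp (p.2.1 • x₁ + p.1.1 • y₁ + (p.2.2 • x₂ + p.1.2 • y₂)) *
          qPow τ (p.1.1 * p.2.1 + p.1.2 * p.2.2)) := by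
  rw [ggTrunc, map_sum, ← Finset.filter_filter]
  rw [Finset.sum_filter_of_ne (p := fun p : (ℕ × ℕ) × (ℕ × ℕ) =>
    p.1.1 * p.2.1 + p.1.2 * p.2.2 ≤ N)]
  · rw [Finset.sum_filter, Finset.sum_filter,
      Finset.sum_product (s := Finset.Icc 1 N ×ˢ Finset.Icc 1 N)]
    refine Finset.sum_congr rfl fun p hp => ?_
    rw [Finset.mem_product, Finset.mem_Icc, Finset.mem_Icc] at hp
    by_cases h : p.2 < p.1
    · simp only [h, if_true]
      rw [map_mul, modq_Lser hp.1.1 N hx₁ hy₁, modq_Lser hp.2.1 N hx₂ hy₂, Finset.sum_mul_sum,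
        ← Finset.sum_product']
      refine Finset.sum_congr rfl fun n _ => ?_
      rw [← map_mul, mvExp_add (x := n.1 • x₁ + p.1 • y₁) (by simp [hx₁, hy₁]) (by simp [hx₂, hy₂]),
        qPow_add,
        mul_mul_mul_comm]
    · simp only [h, if_false, Finset.sum_const_zero]
  · intro p _ h
    by_contra hN
    exact h (by rw [map_mul, modq_qPow (by omega), mul_zero])

/-- The indices describe a partition with parts m₁ > m₂ of multiplicities n₁, n₂. Its conjugate has
parts n₁+n₂ > n₁ of multiplicities m₂, m₁-m₂. Conjugation is an involution preserving m₁n₁ + m₂n₂,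
and it transforms the exponent by exactly the stated change of variables. -/
theorem modq_ggTrunc_swap (N : ℕ) {x₁ x₂ y₁ y₂ : MvPowerSeries τ QSer}
    (hx₁ : x₁.constantCoeff = 0)
    (hx₂ : x₂.constantCoeff = 0) (hy₁ : y₁.constantCoeff = 0) (hy₂ : y₂.constantCoeff = 0) :
    modq τ N (ggTrunc N x₁ x₂ y₁ y₂) = modq τ N (ggTrunc N (y₁ + y₂) y₁ x₂ (x₁ - x₂)) := by
  rw [modq_ggTrunc N hx₁ hx₂ hy₁ hy₂, modq_ggTrunc N (by simp [hy₁, hy₂]) hy₁ hx₂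
    (by simp [hx₁, hx₂])]
  -- Writing m₁ = m + a with m = m₂ removes the truncated subtraction m₁ - m₂.
  have key (p : (ℕ × ℕ) × (ℕ × ℕ))
      (hp : p ∈ ((Finset.Icc 1 N ×ˢ Finset.Icc 1 N) ×ˢ (Finset.Icc 1 N ×ˢ Finset.Icc 1 N)).filter
        fun p => p.1.2 < p.1.1 ∧ p.1.1 * p.2.1 + p.1.2 * p.2.2 ≤ N) :
      ∃ m n a b, p = ((m + a, m), (n, b)) ∧ 1 ≤ m ∧ 1 ≤ n ∧ 1 ≤ a ∧ 1 ≤ b ∧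
        (m + a) * n + m * b ≤ N := by
    obtain ⟨⟨m', m⟩, ⟨n, b⟩⟩ := p
    simp only [Finset.mem_filter, Finset.mem_product, Finset.mem_Icc] at hp
    obtain ⟨a, rfl⟩ := Nat.exists_eq_add_of_le hp.2.1.le
    exact ⟨m, n, a, b, rfl, by omega, by omega, by omega, by omega, hp.2.2⟩
  have mem (m n a b : ℕ) (hm : 1 ≤ m) (hn : 1 ≤ n) (ha : 1 ≤ a) (hb : 1 ≤ b)
      (h : (m + a) * n + m * b ≤ N) :
      ((n + b, n), (m, a)) ∈
        ((Finset.Icc 1 N ×ˢ Finset.Icc 1 N) ×ˢ (Finset.Icc 1 N ×ˢ Finset.Icc 1 N)).filter (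
        fun p => p.1.2 < p.1.1 ∧ p.1.1 * p.2.1 + p.1.2 * p.2.2 ≤ N) := by
    simp only [Finset.mem_filter, Finset.mem_product, Finset.mem_Icc]
    refine ⟨⟨⟨⟨by omega, ?_⟩, ⟨by omega, ?_⟩⟩, ⟨⟨by omega, ?_⟩, ⟨by omega, ?_⟩⟩⟩,
      by omega, ?_⟩ <;> nlinarith
  refine Finset.sum_nbij' (fun p => ((p.2.1 + p.2.2, p.2.1), (p.1.2, p.1.1 - p.1.2)))
    (fun p => ((p.2.1 + p.2.2, p.2.1), (p.1.2, p.1.1 - p.1.2))) ?_ ?_ ?_ ?_ ?_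
  · intro p hp
    obtain ⟨m, n, a, b, rfl, hm, hn, ha, hb, h⟩ := key p hp
    simpa using mem m n a b hm hn ha hb h
  · intro p hp
    obtain ⟨m, n, a, b, rfl, hm, hn, ha, hb, h⟩ := key p hp
    simpa using mem m n a b hm hn ha hb h
  · intro p hp
    obtain ⟨m, n, a, b, rfl, hm, hn, ha, hb, h⟩ := key p hp
    simp
  · intro p hp
    obtain ⟨m, n, a, b, rfl, hm, hn, ha, hb, h⟩ := key p hp
    simp
  · intro p hp
    obtain ⟨m, n, a, b, rfl, hm, hn, ha, hb, h⟩ := key p hp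
    simp only [Nat.add_sub_cancel_left]
    congr 2
    · congr 1
      simp only [nsmul_eq_mul, Nat.cast_add]
      ring
    · congr 1
      ring

end CombEis

/-! ### 𝔏_m and 𝔤^∗ in small depth -/

namespace CombEis

variable {τ : Type*}

theorem frakL_eval (β : Mould ℚ) {m : ℕ} (hm : 1 ≤ m) {r : ℕ} (x y : Fin r → MvPowerSeries τ QSer)
    (hx : ∀ i, (x i).constantCoeff = 0) (hy : ∀ i, (y i).constantCoeff = 0) :
    (frakL β m).eval x y = ∑ j : Fin r,
      (Bimould.ofMould β).eval (fun i : Fin j => x ⟨i, by omega⟩ - x j)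
        (fun i : Fin j => y ⟨i, by omega⟩) *
      Lser m (x j) (∑ i, y i) *
      (bTilde β).eval (fun i : Fin (r - 1 - j) => x ⟨r - 1 - i, by omega⟩ - x j)
        (fun i : Fin (r - 1 - j) => y ⟨r - 1 - i, by omega⟩) := by
  have hs := hasSubst_elim hx hy
  have hz : ∀ i, (Sum.elim x y i).constantCoeff = 0 := by
    rintro (i | i)
    exacts [hx i, hy i]
  rw [Bimould.eval, frakL, subst_sum hs]
  refine Finset.sum_congr rfl fun j _ => ?_
  rw [MvPowerSeries.subst_mul hs, MvPowerSeries.subst_mul hs,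
    Bimould.eval_eval _ _ _ _ (by simp) (by simp) hz,
    Bimould.eval_eval _ _ _ _ (by simp) (by simp) hz,
    subst_Lser hz (by simp) (by simp) hm]
  simp only [MvPowerSeries.subst_sub hs, MvPowerSeries.subst_X hs, Sum.elim_inl, Sum.elim_inr,
    subst_sum hs]

section

variable {β : Mould ℚ} (h0 : MvPowerSeries.coeff 0 (β 0) = 1) {m : ℕ} (hm : 1 ≤ m)
include h0 hm

theorem frakL_eval_one {r : ℕ} (hr : r = 1) (x y : Fin r → MvPowerSeries τ QSer)
    (hx : ∀ i, (x i).constantCoeff = 0) (hy : ∀ i, (y i).constantCoeff = 0) :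
    (frakL β m).eval x y = Lser m (x ⟨0, by omega⟩) (y ⟨0, by omega⟩) := by
  subst hr
  rw [frakL_eval β hm x y hx hy, Fin.sum_univ_one, Fin.sum_univ_one, ofMould_eval_zero h0 rfl,
    bTilde_eval_zero h0 rfl, one_mul, mul_one]
  rfl

theorem frakL_eval_two {r : ℕ} (hr : r = 2) (x y : Fin r → MvPowerSeries τ QSer)
    (hx : ∀ i, (x i).constantCoeff = 0) (hy : ∀ i, (y i).constantCoeff = 0) :
    (frakL β m).eval x y =
      Lser m (x ⟨0, by omega⟩) (y ⟨0, by omega⟩ + y ⟨1, by omega⟩) *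
        ((depthOne β).subst (x ⟨1, by omega⟩ - x ⟨0, by omega⟩) +
          (depthOne β).subst (-y ⟨1, by omega⟩) - algebraMap ℚ _ (1 / 2)) +
      ((depthOne β).subst (x ⟨0, by omega⟩ - x ⟨1, by omega⟩) +
          (depthOne β).subst (y ⟨0, by omega⟩)) *
        Lser m (x ⟨1, by omega⟩) (y ⟨0, by omega⟩ + y ⟨1, by omega⟩) := by
  subst hr
  rw [frakL_eval β hm x y hx hy, Fin.sum_univ_two, Fin.sum_univ_two, ofMould_eval_zero h0 rfl,
    bTilde_eval_one h0 rfl, ofMould_eval_one h0 rfl, bTilde_eval_zero h0 rfl, one_mul, mul_one]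
  · rfl
  · intro i
    rw [map_sub, hx, hx, sub_zero]
  · exact fun _ => hy _
  · intro i
    rw [map_sub, hx, hx, sub_zero]
  · exact fun _ => hy _

end

/-- The coefficient of q^n is defined with the cutoff m_i ≤ n, but terms with some m_i > n
contribute nothing to it, so the common cutoff N serves all n ≤ N. -/
theorem modq_gStar (β : Mould ℚ) (N r : ℕ) :
    modq _ N (gStar β r) = modq _ N (∑ c : Composition r,
      ∑ m ∈ (Fintype.piFinset fun _ : Fin c.length => Finset.Icc 1 N) with StrictAnti m,
        gStarTerm β c m) := by
  rw [modq_eq_modq_iff_coeff]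
  intro e n hn
  rw [MvPowerSeries.coeff_apply (gStar β r), gStar, PowerSeries.coeff_mk]
  simp only [map_sum]
  refine Finset.sum_congr rfl fun c _ => Finset.sum_subset ?_ ?_
  · refine Finset.filter_subset_filter _ (Fintype.piFinset_subset _ _ fun _ => ?_)
    exact Finset.Icc_subset_Icc_right hn
  · intro m hm hm'
    simp only [Finset.mem_filter, Fintype.mem_piFinset, Finset.mem_Icc] at hm hm'
    by_contra h
    refine hm' ⟨fun i => ⟨(hm.1 i).1, ?_⟩, hm.2⟩
    by_contra hi
    exact h (coeff_gStarTerm_eq_zero β c m i (not_le.mp hi) e)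

theorem modq_gStar_eval (β : Mould ℚ) (N : ℕ) {r : ℕ} (x y : Fin r → MvPowerSeries τ QSer)
    (hx : ∀ i, (x i).constantCoeff = 0) (hy : ∀ i, (y i).constantCoeff = 0) :
    modq _ N ((gStar β).eval x y) = modq _ N (∑ c : Composition r,
      ∑ m ∈ (Fintype.piFinset fun _ : Fin c.length => Finset.Icc 1 N) with StrictAnti m,
        ∏ i : Fin c.length, (frakL β (m i)).eval (fun t => x (c.embedding i t))
          (fun t => y (c.embedding i t))) := by
  have hs := hasSubst_elim hx hy
  have hz : ∀ i, (Sum.elim x y i).constantCoeff = 0 := by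
    rintro (i | i)
    exacts [hx i, hy i]
  rw [Bimould.eval, modq_subst hs (modq_gStar β N r), subst_sum hs]
  congr 1
  refine Finset.sum_congr rfl fun c _ => ?_
  rw [subst_sum hs]
  refine Finset.sum_congr rfl fun m _ => ?_
  rw [gStarTerm, ← MvPowerSeries.substAlgHom_apply hs, map_prod]
  refine Finset.prod_congr rfl fun i _ => ?_
  rw [MvPowerSeries.substAlgHom_apply hs, Bimould.eval_eval _ _ _ _ (by simp) (by simp) hz]
  simp only [MvPowerSeries.subst_X hs, Sum.elim_inl, Sum.elim_inr]

theorem sum_composition_zero {M : Type*} [AddCommMonoid M] (f : Composition 0 → M) :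
    ∑ c, f c = f ⟨[], by simp, rfl⟩ := by
  have h : (Finset.univ : Finset (Composition 0)) = {⟨[], by simp, rfl⟩} := by
    symm
    rw [← Finset.card_eq_iff_eq_univ, composition_card]
    rfl
  rw [h, Finset.sum_singleton]

theorem sum_composition_one {M : Type*} [AddCommMonoid M] (f : Composition 1 → M) :
    ∑ c, f c = f ⟨[1], by simp, rfl⟩ := by
  have h : (Finset.univ : Finset (Composition 1)) = {⟨[1], by simp, rfl⟩} := by
    symm
    rw [← Finset.card_eq_iff_eq_univ, composition_card]
    rfl
  rw [h, Finset.sum_singleton]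

/-- The list is exhaustive by counting: there are 2^{2-1} compositions of 2. -/
theorem sum_composition_two {M : Type*} [AddCommMonoid M] (f : Composition 2 → M) :
    ∑ c, f c = f ⟨[1, 1], by simp, rfl⟩ + f ⟨[2], by simp, rfl⟩ := by
  have hne : (⟨[1, 1], by simp, rfl⟩ : Composition 2) ≠ ⟨[2], by simp, rfl⟩ := by
    intro h
    simpa using congrArg Composition.blocks h
  have h : (Finset.univ : Finset (Composition 2)) =
      {⟨[1, 1], by simp, rfl⟩, ⟨[2], by simp, rfl⟩} := by
    symm
    rw [← Finset.card_eq_iff_eq_univ, composition_card, Finset.card_pair hne]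
    rfl
  rw [h, Finset.sum_pair hne]

theorem sum_piFinset_zero {M : Type*} [AddCommMonoid M] (s : Finset ℕ) (f : (Fin 0 → ℕ) → M) :
    ∑ m ∈ (Fintype.piFinset fun _ : Fin 0 => s) with StrictAnti m, f m = f ![] := by
  have h : ((Fintype.piFinset fun _ : Fin 0 => s).filter StrictAnti) = {![]} := by
    ext m
    simp [Subsingleton.strictAnti, eq_iff_true_of_subsingleton]
  rw [h, Finset.sum_singleton]

theorem sum_piFinset_one {M : Type*} [AddCommMonoid M] (s : Finset ℕ) (f : (Fin 1 → ℕ) → M) :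
    ∑ m ∈ (Fintype.piFinset fun _ : Fin 1 => s) with StrictAnti m, f m = ∑ m ∈ s, f ![m] := by
  refine Finset.sum_nbij' (fun m => m 0) (fun m => ![m]) ?_ ?_ ?_ ?_ ?_
  · intro m hm
    exact Fintype.mem_piFinset.mp (Finset.mem_filter.mp hm).1 0
  · intro m hm
    simp [hm, Subsingleton.strictAnti]
  · intro m _
    ext1 i
    rw [Subsingleton.elim i 0]
    rfl
  · simp
  · intro m _
    congr 1
    ext1 i
    rw [Subsingleton.elim i 0]
    rfl

theorem sum_piFinset_two {M : Type*} [AddCommMonoid M] (s : Finset ℕ) (f : (Fin 2 → ℕ) → M) :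
    ∑ m ∈ (Fintype.piFinset fun _ : Fin 2 => s) with StrictAnti m, f m =
      ∑ p ∈ s ×ˢ s with p.2 < p.1, f ![p.1, p.2] := by
  refine Finset.sum_nbij' (fun m => (m 0, m 1)) (fun p => ![p.1, p.2]) ?_ ?_ ?_ ?_ ?_
  · intro m hm
    simp only [Finset.mem_filter, Fintype.mem_piFinset, Finset.mem_product] at hm ⊢
    exact ⟨⟨hm.1 0, hm.1 1⟩, hm.2 (by decide)⟩
  · intro p hp
    simp only [Finset.mem_filter, Fintype.mem_piFinset, Finset.mem_product] at hp ⊢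
    refine ⟨fun i => ?_, ?_⟩
    · fin_cases i
      exacts [hp.1.1, hp.1.2]
    · rw [Fin.strictAnti_iff_succ_lt]
      intro i
      fin_cases i
      exact hp.2
  · intro m _
    ext1 i
    fin_cases i <;> rfl
  · simp
  · intro m _
    congr 1
    ext1 i
    fin_cases i <;> rfl

theorem modq_gStar_eval_zero (β : Mould ℚ) (N : ℕ) {r : ℕ} (hr : r = 0)
    (x y : Fin r → MvPowerSeries τ QSer) :
    modq _ N ((gStar β).eval x y) = 1 := by
  subst hr
  rw [modq_gStar_eval β N x y nofun nofun, ← map_one (modq τ N)]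
  congr 1
  rw [sum_composition_zero]
  exact (sum_piFinset_zero _ _).trans (Fin.prod_univ_zero _)

section

variable {β : Mould ℚ} (h0 : MvPowerSeries.coeff 0 (β 0) = 1) (N : ℕ)
include h0

theorem modq_gStar_eval_one {r : ℕ} (hr : r = 1) (x y : Fin r → MvPowerSeries τ QSer)
    (hx : ∀ i, (x i).constantCoeff = 0) (hy : ∀ i, (y i).constantCoeff = 0) :
    modq _ N ((gStar β).eval x y) =
      modq _ N (gTrunc N (x ⟨0, by omega⟩) (y ⟨0, by omega⟩)) := by
  subst hr
  rw [modq_gStar_eval β N x y hx hy, sum_composition_one]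
  congr 1
  refine (sum_piFinset_one _ _).trans (Finset.sum_congr rfl fun m hm => ?_)
  refine (Fin.prod_univ_one _).trans ?_
  exact frakL_eval_one h0 (Finset.mem_Icc.mp hm).1 rfl _ _ (fun _ => hx _) (fun _ => hy _)

theorem modq_gStar_eval_two {r : ℕ} (hr : r = 2) (x y : Fin r → MvPowerSeries τ QSer)
    (hx : ∀ i, (x i).constantCoeff = 0) (hy : ∀ i, (y i).constantCoeff = 0) :
    modq _ N ((gStar β).eval x y) =
      modq _ N (ggTrunc N (x ⟨0, by omega⟩) (x ⟨1, by omega⟩) (y ⟨0, by omega⟩)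
        (y ⟨1, by omega⟩) + ∑ m ∈ Finset.Icc 1 N, (frakL β m).eval x y) := by
  subst hr
  rw [modq_gStar_eval β N x y hx hy, sum_composition_two]
  congr 2
  · refine (sum_piFinset_two _ _).trans (Finset.sum_congr rfl fun p hp => ?_)
    rw [Finset.mem_filter, Finset.mem_product, Finset.mem_Icc, Finset.mem_Icc] at hp
    refine (Fin.prod_univ_two _).trans ?_
    refine congrArg₂ _
      ((frakL_eval_one h0 hp.1.1.1 rfl _ _ (fun _ => hx _) (fun _ => hy _)).trans ?_)
      ((frakL_eval_one h0 hp.1.2.1 rfl _ _ (fun _ => hx _) (fun _ => hy _)).trans ?_)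
    · rfl
    · rfl
  · refine (sum_piFinset_one _ _).trans (Finset.sum_congr rfl fun m hm => ?_)
    refine (Fin.prod_univ_one _).trans ?_
    change (frakL β m).eval (r := 2) _ _ = _
    congr 1 <;> ext1 i <;> fin_cases i <;> rfl

end

end CombEis

/-! ### Quasi-shuffle relation and swap invariance of 𝔊 -/

namespace CombEis

variable {τ : Type*}

section

variable {β : Mould ℚ} (h0 : MvPowerSeries.coeff 0 (β 0) = 1) (N : ℕ)
include h0

theorem modq_frakG_eval_one {x y : MvPowerSeries τ QSer} (hx : x.constantCoeff = 0)
    (hy : y.constantCoeff = 0) :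
    modq τ N ((frakG β).eval ![x] ![y]) =
      modq τ N (gTrunc N x y + (depthOne β).subst x + (depthOne β).subst y) := by
  have hx' : ∀ i, (![x] i).constantCoeff = 0 := fun i => by
    fin_cases i
    exact hx
  have hy' : ∀ i, (![y] i).constantCoeff = 0 := fun i => by
    fin_cases i
    exact hy
  rw [frakG, Bimould.eval_mul _ _ _ _ hx' hy', Fin.sum_univ_two, map_add, map_mul, map_mul,
    modq_gStar_eval_zero β N rfl, modq_gStar_eval_one h0 N rfl, ofMould_eval_zero h0 rfl,
    ofMould_eval_one h0 rfl, one_mul, map_one, mul_one, ← map_add, add_comm, ← add_assoc]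
  · rfl
  · exact fun _ => hx' _
  · exact fun _ => hy' _
  · exact fun _ => hx' _
  · exact fun _ => hy' _

theorem modq_frakG_eval_two {x₁ x₂ y₁ y₂ : MvPowerSeries τ QSer} (hx₁ : x₁.constantCoeff = 0)
    (hx₂ : x₂.constantCoeff = 0) (hy₁ : y₁.constantCoeff = 0) (hy₂ : y₂.constantCoeff = 0) :
    modq τ N ((frakG β).eval ![x₁, x₂] ![y₁, y₂]) =
      modq τ N (ggTrunc N x₁ x₂ y₁ y₂ +
        (gTrunc N x₁ (y₁ + y₂) * ((depthOne β).subst (x₂ - x₁) + (depthOne β).subst (-y₂) -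
            algebraMap ℚ _ (1 / 2)) +
          ((depthOne β).subst (x₁ - x₂) + (depthOne β).subst y₁) * gTrunc N x₂ (y₁ + y₂)) +
        gTrunc N x₁ y₁ * ((depthOne β).subst x₂ + (depthOne β).subst y₂) +
        (β.eval ![x₁, x₂] + (depthOne β).subst y₁ * (depthOne β).subst x₂ +
          (β.eval ![y₁ + y₂, y₁] + algebraMap ℚ _ (PowerSeries.coeff 2 β.gammaSeries)))) := by
  have hx' : ∀ i, (![x₁, x₂] i).constantCoeff = 0 := fun i => by
    fin_cases i
    exacts [hx₁, hx₂]
  have hy' : ∀ i, (![y₁, y₂] i).constantCoeff = 0 := fun i => by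
    fin_cases i
    exacts [hy₁, hy₂]
  rw [frakG, Bimould.eval_mul _ _ _ _ hx' hy', Fin.sum_univ_three, map_add, map_add, map_mul,
    map_mul, map_mul, modq_gStar_eval_zero β N rfl, modq_gStar_eval_one h0 N rfl,
    modq_gStar_eval_two h0 N rfl, ofMould_eval_zero h0 rfl,
    ofMould_eval_one h0 rfl, ofMould_eval_two h0 rfl, one_mul, map_one, mul_one, ← map_mul,
    ← map_add, ← map_add]
  · have hL (m : ℕ) (hm : m ∈ Finset.Icc 1 N) :
        (frakL β m).eval (fun i : Fin ((2 : Fin 3) : ℕ) => ![x₁, x₂] ⟨i, by omega⟩)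
          (fun i : Fin ((2 : Fin 3) : ℕ) => ![y₁, y₂] ⟨i, by omega⟩) =
        Lser m x₁ (y₁ + y₂) * ((depthOne β).subst (x₂ - x₁) + (depthOne β).subst (-y₂) -
            algebraMap ℚ _ (1 / 2)) +
          ((depthOne β).subst (x₁ - x₂) + (depthOne β).subst y₁) * Lser m x₂ (y₁ + y₂) :=
      frakL_eval_two h0 (Finset.mem_Icc.mp hm).1 rfl _ _ (fun _ => hx' _) (fun _ => hy' _)
    rw [Finset.sum_congr rfl hL, Finset.sum_add_distrib, ← Finset.sum_mul,
      ← Finset.mul_sum]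
    congr 1
    change β.eval ![x₁, x₂] + (depthOne β).subst y₁ * (depthOne β).subst x₂ +
          (β.eval ![y₁ + y₂, y₁] + algebraMap ℚ _ (PowerSeries.coeff 2 β.gammaSeries)) +
        gTrunc N x₁ y₁ * ((depthOne β).subst x₂ + (depthOne β).subst y₂) +
      (ggTrunc N x₁ x₂ y₁ y₂ +
        (gTrunc N x₁ (y₁ + y₂) * ((depthOne β).subst (x₂ - x₁) + (depthOne β).subst (-y₂) -
            algebraMap ℚ _ (1 / 2)) +
          ((depthOne β).subst (x₁ - x₂) + (depthOne β).subst y₁) * gTrunc N x₂ (y₁ + y₂))) = _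
    ring
  all_goals first | exact fun _ => hx' _ | exact fun _ => hy' _

end

/-- e^u - 1 is u times a unit. In the domain of power series this permits cancelling the denominator
of the partial fractions. -/
theorem mvExp_sub_one_ne_zero {u : MvPowerSeries τ QSer} (hu : u.constantCoeff = 0) (h : u ≠ 0) :
    mvExp u - 1 ≠ 0 := by
  have hs := PowerSeries.HasSubst.of_constantCoeff_zero hu
  obtain ⟨f, hf⟩ : PowerSeries.X ∣ PowerSeries.exp ℚ - 1 := by
    rw [PowerSeries.X_dvd_iff]
    simp
  have hf1 : IsUnit f := by
    rw [PowerSeries.isUnit_iff_constantCoeff]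
    have := congrArg (PowerSeries.coeff 1) hf
    rw [← zero_add 1, PowerSeries.coeff_succ_X_mul, PowerSeries.coeff_zero_eq_constantCoeff_apply]
      at this
    rw [← this]
    simp [PowerSeries.coeff_one]
  have hE := congrArg (PowerSeries.substAlgHom hs) hf
  rw [map_sub, map_one, map_mul, PowerSeries.substAlgHom_X hs] at hE
  have hE' : mvExp u - 1 = u * PowerSeries.substAlgHom hs f := by
    rw [← hE, PowerSeries.coe_substAlgHom, mvExp]
  rw [hE']
  exact mul_ne_zero h (hf1.map (PowerSeries.substAlgHom hs)).ne_zero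

variable {β : Mould ℚ} (hβ : IsRationalSolution β)
include hβ

/-- With E = e^{x₂-x₁} and P_i = L_m(x_i;y₁+y₂), partial fractions give L_m(x₁;y₁)L_m(x₂;y₂) = (P₂ -
E·P₁)/(E-1). Inserting 1/(E-1) = 1/(x₂-x₁) - 1/2 - 2β(x₂-x₁) and E/(E-1) = 1 + 1/(E-1) produces the
coefficients 2β ∓ 1/2. -/
theorem IsRationalSolution.Lser_mul_Lser {m : ℕ} (hm : 1 ≤ m) {x₁ x₂ y₁ y₂ : MvPowerSeries τ QSer}
    (hx₁ : x₁.constantCoeff = 0)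
    (hx₂ : x₂.constantCoeff = 0) (hy₁ : y₁.constantCoeff = 0) (hy₂ : y₂.constantCoeff = 0) :
    (x₁ - x₂) * (Lser m x₁ y₁ * Lser m x₂ y₂ -
      Lser m x₁ (y₁ + y₂) * (2 * (depthOne β).subst (x₂ - x₁) - algebraMap ℚ _ (1 / 2)) +
      Lser m x₂ (y₁ + y₂) * (2 * (depthOne β).subst (x₂ - x₁) + algebraMap ℚ _ (1 / 2))) =
    Lser m x₁ (y₁ + y₂) - Lser m x₂ (y₁ + y₂) := by
  have hc {y : MvPowerSeries τ QSer} (hy : y.constantCoeff = 0) : (m • y).constantCoeff = 0 := by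
    rw [map_nsmul, hy, smul_zero]
  by_cases hne : x₂ - x₁ = 0
  -- For x₁ = x₂ the factor E - 1 cannot be cancelled, but both sides vanish.
  · rw [sub_eq_zero.mp hne, sub_self, sub_self, zero_mul]
  have hu : (x₂ - x₁).constantCoeff = 0 := by rw [map_sub, hx₁, hx₂, sub_zero]
  refine mul_left_cancel₀ (mvExp_sub_one_ne_zero hu hne) ?_
  have hB := hβ.depthOne_subst_exp hu
  rw [← mvExp] at hB
  have hx : mvExp x₂ = mvExp x₁ * mvExp (x₂ - x₁) := by
    rw [← mvExp_add hx₁ hu, add_sub_cancel]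
  have hh : (2 : MvPowerSeries τ QSer) * algebraMap ℚ _ (1 / 2) = 1 := by
    rw [← map_ofNat (algebraMap ℚ (MvPowerSeries τ QSer)) 2, ← map_mul]
    norm_num
  have h1 := Ring.mul_inverse_cancel _ (isUnit_denominator hm x₁)
  have h2 := Ring.mul_inverse_cancel _ (isUnit_denominator hm x₂)
  simp only [Lser, smul_add, mvExp_add hx₁ (hc hy₁), mvExp_add hx₂ (hc hy₂),
    mvExp_add hx₁ (y := m • y₁ + m • y₂) (by simp [hy₁, hy₂]),
    mvExp_add hx₂ (y := m • y₁ + m • y₂) (by simp [hy₁, hy₂]), mvExp_add (hc hy₁) (hc hy₂)]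
  set I₁ := Ring.inverse (1 - mvExp x₁ * qPow τ m)
  set I₂ := Ring.inverse (1 - mvExp x₂ * qPow τ m)
  rw [hx] at h2 ⊢
  generalize mvExp (x₂ - x₁) = E at *
  generalize mvExp x₁ = a at *
  generalize mvExp (m • y₁) = M₁ at *
  generalize mvExp (m • y₂) = M₂ at *
  generalize qPow τ m = q at *
  generalize (depthOne β).subst (x₂ - x₁) = B at *
  generalize algebraMap ℚ (MvPowerSeries τ QSer) (1 / 2) = h at *
  -- The partial fraction identity: the two denominators 1 - aq and 1 - aEq differ by aq(E-1).
  have hP : (E - 1) * (a * M₁ * q * I₁ * (a * E * M₂ * q * I₂)) =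
      a * E * (M₁ * M₂) * q * I₂ - E * (a * (M₁ * M₂) * q * I₁) := by
    linear_combination (a * E * (M₁ * M₂) * q) * (I₂ * h1 - I₁ * h2)
  set P₁ := a * (M₁ * M₂) * q * I₁
  set P₂ := a * E * (M₁ * M₂) * q * I₂
  linear_combination (x₁ - x₂) * hP + (P₁ - P₂) * hB +
    ((x₂ - x₁) * (E - 1) * (-P₁)) * hh

/-- The relation for the diagonal terms is linear in them once summed over m. It holds exactly,
since all sums share the cutoff N. -/
theorem IsRationalSolution.gTrunc_mul_gTrunc (N : ℕ) {x₁ x₂ y₁ y₂ : MvPowerSeries τ QSer}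
    (hx₁ : x₁.constantCoeff = 0)
    (hx₂ : x₂.constantCoeff = 0) (hy₁ : y₁.constantCoeff = 0) (hy₂ : y₂.constantCoeff = 0) :
    (x₁ - x₂) * (gTrunc N x₁ y₁ * gTrunc N x₂ y₂ - ggTrunc N x₁ x₂ y₁ y₂ -
        ggTrunc N x₂ x₁ y₂ y₁ -
      gTrunc N x₁ (y₁ + y₂) * (2 * (depthOne β).subst (x₂ - x₁) - algebraMap ℚ _ (1 / 2)) +
      gTrunc N x₂ (y₁ + y₂) * (2 * (depthOne β).subst (x₂ - x₁) + algebraMap ℚ _ (1 / 2))) =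
    gTrunc N x₁ (y₁ + y₂) - gTrunc N x₂ (y₁ + y₂) := by
  have h : ∑ m ∈ Finset.Icc 1 N, _ = ∑ m ∈ Finset.Icc 1 N, _ := Finset.sum_congr rfl fun m hm =>
    hβ.Lser_mul_Lser (Finset.mem_Icc.mp hm).1 hx₁ hx₂ hy₁ hy₂
  rw [← Finset.mul_sum, Finset.sum_add_distrib, Finset.sum_sub_distrib, Finset.sum_sub_distrib,
    ← Finset.sum_mul, ← Finset.sum_mul] at h
  rw [CombEis.gTrunc_mul_gTrunc, gTrunc, gTrunc]
  linear_combination h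

/-- The quasi-shuffle relation of `𝔊` in depth two. -/
theorem IsRationalSolution.frakG_mul_frakG {x₁ x₂ y₁ y₂ : MvPowerSeries τ QSer}
    (hx₁ : x₁.constantCoeff = 0)
    (hx₂ : x₂.constantCoeff = 0) (hy₁ : y₁.constantCoeff = 0) (hy₂ : y₂.constantCoeff = 0) :
    (x₁ - x₂) * ((frakG β).eval ![x₁] ![y₁] * (frakG β).eval ![x₂] ![y₂] -
      (frakG β).eval ![x₁, x₂] ![y₁, y₂] - (frakG β).eval ![x₂, x₁] ![y₂, y₁]) =
    (frakG β).eval ![x₁] ![y₁ + y₂] - (frakG β).eval ![x₂] ![y₁ + y₂] := by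
  have h0 := hβ.coeff_zero
  have hy : (y₁ + y₂).constantCoeff = 0 := by rw [map_add, hy₁, hy₂, add_zero]
  refine eq_of_modq fun N => ?_
  simp only [map_mul, map_sub]
  rw [modq_frakG_eval_one h0 N hx₁ hy₁, modq_frakG_eval_one h0 N hx₂ hy₂,
    modq_frakG_eval_one h0 N hx₁ hy, modq_frakG_eval_one h0 N hx₂ hy,
    modq_frakG_eval_two h0 N hx₁ hx₂ hy₁ hy₂, modq_frakG_eval_two h0 N hx₂ hx₁ hy₂ hy₁]
  simp only [← map_mul, ← map_sub]
  congr 1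
  have e1 : (depthOne β).subst (x₁ - x₂) = -(depthOne β).subst (x₂ - x₁) := by
    rw [← hβ.depthOne_subst_neg (by rw [map_sub, hx₁, hx₂, sub_zero]), neg_sub]
  have e2 := hβ.gTrunc_mul_gTrunc N hx₁ hx₂ hy₁ hy₂
  have e3 := hβ.eds.1.depthOne_mul hx₁ hx₂
  have e4 := hβ.depthOne_mul_eq_gam hy₁ hy₂
  rw [e1, hβ.depthOne_subst_neg hy₁, hβ.depthOne_subst_neg hy₂, add_comm y₂ y₁]
  rw [add_comm y₂ y₁] at e4
  -- `e2` accounts for products of two q-series, `e3` for β(x₁)β(x₂) and `e4` for β(y₁)β(y₂)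
  -- together with 2γ₂. The mixed products cancel identically, because β is odd.
  linear_combination e2 + e3 + (x₁ - x₂) * e4

/-- The swap invariance of `𝔊` in depth one. -/
theorem IsRationalSolution.frakG_swap_one {x y : MvPowerSeries τ QSer} (hx : x.constantCoeff = 0)
    (hy : y.constantCoeff = 0) : (frakG β).eval ![x] ![y] = (frakG β).eval ![y] ![x] := by
  have h0 := hβ.coeff_zero
  refine eq_of_modq fun N => ?_
  rw [modq_frakG_eval_one h0 N hx hy, modq_frakG_eval_one h0 N hy hx, add_assoc, add_assoc,
    map_add, map_add _ (gTrunc N y x), modq_gTrunc_symm N hx hy,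
    add_comm (PowerSeries.subst x _)]

/-- The swap invariance of `𝔊` in depth two. -/
theorem IsRationalSolution.frakG_swap_two {x₁ x₂ y₁ y₂ : MvPowerSeries τ QSer}
    (hx₁ : x₁.constantCoeff = 0)
    (hx₂ : x₂.constantCoeff = 0) (hy₁ : y₁.constantCoeff = 0) (hy₂ : y₂.constantCoeff = 0) :
    (frakG β).eval ![x₁, x₂] ![y₁, y₂] =
      (frakG β).eval ![y₁ + y₂, y₁] ![x₂, x₁ - x₂] := by
  have h0 := hβ.coeff_zero
  have hy : (y₁ + y₂).constantCoeff = 0 := by rw [map_add, hy₁, hy₂, add_zero]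
  have hx : (x₁ - x₂).constantCoeff = 0 := by rw [map_sub, hx₁, hx₂, sub_zero]
  refine eq_of_modq fun N => ?_
  rw [modq_frakG_eval_two h0 N hx₁ hx₂ hy₁ hy₂, modq_frakG_eval_two h0 N hy hy₁ hx₂ hx,
    add_sub_cancel, add_sub_cancel_left, sub_add_cancel_left]
  have e1 : (depthOne β).subst (x₂ - x₁) = -(depthOne β).subst (x₁ - x₂) := by
    rw [← hβ.depthOne_subst_neg hx, neg_sub]
  rw [e1, hβ.depthOne_subst_neg hx, hβ.depthOne_subst_neg hy₂]
  simp only [map_add, map_mul]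
  -- Under the swap the sum at (x₁;y₁+y₂) is fixed, while those at (x₂;y₁+y₂) and (x₁;y₁) trade
  -- places along with their coefficients.
  rw [modq_ggTrunc_swap N hx₁ hx₂ hy₁ hy₂, modq_gTrunc_symm N hx₁ hy, modq_gTrunc_symm N hx₂ hy,
    modq_gTrunc_symm N hx₁ hy₁]
  simp only [map_sub, map_add, map_neg]
  ring

end CombEis

/-! ### Extraction of coefficients in two pairs of variables -/

namespace CombEis

/-- The exponent of `X₁^a Y₁^c`. -/
def expOne (a c : ℕ) : Fin 1 ⊕ Fin 1 →₀ ℕ :=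
  Finsupp.equivFunOnFinite.symm (Sum.elim ![a] ![c])

/-- The exponent of `X₁^a X₂^b Y₁^c Y₂^d`. -/
def expTwo (a b c d : ℕ) : Fin 2 ⊕ Fin 2 →₀ ℕ :=
  Finsupp.equivFunOnFinite.symm (Sum.elim ![a, b] ![c, d])

theorem expTwo_inj {a b c d a' b' c' d' : ℕ} :
    expTwo a b c d = expTwo a' b' c' d' ↔ a = a' ∧ b = b' ∧ c = c' ∧ d = d' := by
  constructor
  · intro h
    have h' := DFunLike.congr_fun h
    exact ⟨h' (.inl 0), h' (.inl 1), h' (.inr 0), h' (.inr 1)⟩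
  · rintro ⟨rfl, rfl, rfl, rfl⟩
    rfl

theorem eq_expTwo (e : Fin 2 ⊕ Fin 2 →₀ ℕ) :
    e = expTwo (e (.inl 0)) (e (.inl 1)) (e (.inr 0)) (e (.inr 1)) := by
  ext i
  rcases i with i | i <;> fin_cases i <;> rfl

theorem eq_expOne (e : Fin 1 ⊕ Fin 1 →₀ ℕ) : e = expOne (e (.inl 0)) (e (.inr 0)) := by
  ext i
  rcases i with i | i <;> fin_cases i <;> rfl

local notation "X₁" => vX QSer (0 : Fin 2)
local notation "X₂" => vX QSer (1 : Fin 2)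
local notation "Y₁" => vY QSer (0 : Fin 2)
local notation "Y₂" => vY QSer (1 : Fin 2)

theorem monomial_expTwo (a b c d : ℕ) :
    X₁ ^ a * X₂ ^ b * (Y₁ ^ c * Y₂ ^ d) = MvPowerSeries.monomial (expTwo a b c d) 1 := by
  rw [MvPowerSeries.monomial_one_eq, Finsupp.prod_fintype _ _ (by simp), Fintype.prod_sum_type,
    Fin.prod_univ_two, Fin.prod_univ_two]
  rfl

theorem coeff_monomial_expTwo (a b c d a' b' c' d' : ℕ) :
    MvPowerSeries.coeff (expTwo a b c d) (X₁ ^ a' * X₂ ^ b' * (Y₁ ^ c' * Y₂ ^ d')) =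
      if a = a' ∧ b = b' ∧ c = c' ∧ d = d' then 1 else 0 := by
  classical
  rw [monomial_expTwo, MvPowerSeries.coeff_monomial]
  simp only [expTwo_inj]

theorem coeff_X_pow_mul_add_pow (a b c d p n : ℕ) :
    MvPowerSeries.coeff (expTwo a b c d) (X₁ ^ p * (Y₁ + Y₂) ^ n) =
      if p = a ∧ b = 0 ∧ n = c + d then (n.choose c : QSer) else 0 := by
  rw [add_pow, Finset.mul_sum, map_sum]
  have h (j : ℕ) : MvPowerSeries.coeff (expTwo a b c d)
      (X₁ ^ p * (Y₁ ^ j * Y₂ ^ (n - j) * (n.choose j : MvPowerSeries (Fin 2 ⊕ Fin 2) QSer))) =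
      if a = p ∧ b = 0 ∧ c = j ∧ d = n - j then (n.choose j : QSer) else 0 := by
    rw [← map_natCast (MvPowerSeries.C (R := QSer)), ← mul_assoc, MvPowerSeries.coeff_mul_C]
    have := coeff_monomial_expTwo a b c d p 0 j (n - j)
    rw [pow_zero, mul_one] at this
    rw [this, ite_mul, one_mul, zero_mul]
  rw [Finset.sum_congr rfl fun j _ => h j]
  split_ifs with hc
  · rw [Finset.sum_eq_single c, if_pos (by omega)]
    · intro j _ hj
      rw [if_neg (by omega)]
    · intro hj
      rw [Finset.mem_range] at hj
      omega
  · refine Finset.sum_eq_zero fun j hj => ?_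
    rw [Finset.mem_range] at hj
    rw [if_neg (by omega)]

/-- Both binomials are expanded, and X₂^b and Y₁^c select one term of each. For b > p or c > s no
term exists; the binomial coefficient is then 0, so the truncated exponent `s - c` does no harm. -/
theorem coeff_add_pow_mul_sub_pow (a b c d p q r s : ℕ) :
    MvPowerSeries.coeff (expTwo a b c d) ((X₁ + X₂) ^ p * X₁ ^ q * (Y₂ ^ r * (Y₁ - Y₂) ^ s)) =
      if p + q = a + b ∧ r + s = c + d then
        ((p.choose b : QSer) * (s.choose c : QSer) * (-1) ^ (s - c)) else 0 := by
  have h (i j : ℕ) : MvPowerSeries.coeff (expTwo a b c d)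
      (X₂ ^ i * X₁ ^ (p - i) * (p.choose i : MvPowerSeries (Fin 2 ⊕ Fin 2) QSer) * X₁ ^ q *
        (Y₂ ^ r * (Y₁ ^ j * (-Y₂) ^ (s - j) *
          (s.choose j : MvPowerSeries (Fin 2 ⊕ Fin 2) QSer)))) =
      if a = p - i + q ∧ b = i ∧ c = j ∧ d = r + (s - j) then
        ((p.choose i : QSer) * (s.choose j : QSer) * (-1) ^ (s - j)) else 0 := by
    have h1 : X₂ ^ i * X₁ ^ (p - i) * (p.choose i : MvPowerSeries (Fin 2 ⊕ Fin 2) QSer) * X₁ ^ q *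
        (Y₂ ^ r * (Y₁ ^ j * (-Y₂) ^ (s - j) *
          (s.choose j : MvPowerSeries (Fin 2 ⊕ Fin 2) QSer))) =
        X₁ ^ (p - i + q) * X₂ ^ i * (Y₁ ^ j * Y₂ ^ (r + (s - j))) *
        MvPowerSeries.C ((p.choose i : QSer) * (s.choose j : QSer) * (-1) ^ (s - j)) := by
      rw [map_mul, map_mul, map_natCast, map_natCast, map_pow, map_neg, map_one, neg_pow Y₂]
      ring
    rw [h1, MvPowerSeries.coeff_mul_C, coeff_monomial_expTwo, ite_mul, one_mul, zero_mul]
  rw [add_comm X₁, add_pow, sub_eq_add_neg, add_pow, Finset.sum_mul, Finset.mul_sum,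
    Finset.sum_mul_sum, map_sum]
  simp only [map_sum]
  rw [Finset.sum_congr rfl fun i _ => Finset.sum_congr rfl fun j _ => h i j]
  split_ifs with hc
  · by_cases hp : b ≤ p
    · by_cases hs : c ≤ s
      · rw [Finset.sum_eq_single b, Finset.sum_eq_single c, if_pos (by omega)]
        · intro j _ hj
          rw [if_neg (by omega)]
        · intro hj
          rw [Finset.mem_range] at hj
          omega
        · intro i _ hi
          refine Finset.sum_eq_zero fun j hj => ?_
          rw [if_neg (by omega)]
        · intro hj
          rw [Finset.mem_range] at hj
          omega
      · rw [Nat.choose_eq_zero_of_lt (not_le.mp hs), Nat.cast_zero, mul_zero, zero_mul]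
        refine Finset.sum_eq_zero fun i hi => Finset.sum_eq_zero fun j hj => ?_
        rw [Finset.mem_range] at hi hj
        rw [if_neg (by omega)]
    · rw [Nat.choose_eq_zero_of_lt (not_le.mp hp), Nat.cast_zero, zero_mul, zero_mul]
      refine Finset.sum_eq_zero fun i hi => Finset.sum_eq_zero fun j hj => ?_
      rw [Finset.mem_range] at hi hj
      rw [if_neg (by omega)]
  · refine Finset.sum_eq_zero fun i hi => Finset.sum_eq_zero fun j hj => ?_
    rw [Finset.mem_range] at hi hj
    rw [if_neg (by omega)]

theorem coeff_eval_one (B : Bimould QSer) {x y : MvPowerSeries (Fin 2 ⊕ Fin 2) QSer}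
    (hx : x.constantCoeff = 0) (hy : y.constantCoeff = 0) (e : Fin 2 ⊕ Fin 2 →₀ ℕ) :
    MvPowerSeries.coeff e (B.eval ![x] ![y]) = ∑ᶠ d : Fin 1 ⊕ Fin 1 →₀ ℕ,
      MvPowerSeries.coeff d (B 1) * MvPowerSeries.coeff e (x ^ d (.inl 0) * y ^ d (.inr 0)) := by
  rw [Bimould.eval, MvPowerSeries.coeff_subst (hasSubst_elim _ _)]
  · refine finsum_congr fun d => ?_
    rw [Finsupp.prod_fintype _ _ (by simp), Fintype.prod_sum_type, Fin.prod_univ_one,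
      Fin.prod_univ_one]
    rfl
  · intro i
    fin_cases i
    exact hx
  · intro i
    fin_cases i
    exact hy

theorem coeff_eval_two (B : Bimould QSer) {x₁ x₂ y₁ y₂ : MvPowerSeries (Fin 2 ⊕ Fin 2) QSer}
    (hx₁ : x₁.constantCoeff = 0) (hx₂ : x₂.constantCoeff = 0) (hy₁ : y₁.constantCoeff = 0)
    (hy₂ : y₂.constantCoeff = 0) (e : Fin 2 ⊕ Fin 2 →₀ ℕ) :
    MvPowerSeries.coeff e (B.eval ![x₁, x₂] ![y₁, y₂]) = ∑ᶠ d : Fin 2 ⊕ Fin 2 →₀ ℕ,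
      MvPowerSeries.coeff d (B 2) * MvPowerSeries.coeff e
        (x₁ ^ d (.inl 0) * x₂ ^ d (.inl 1) * (y₁ ^ d (.inr 0) * y₂ ^ d (.inr 1))) := by
  rw [Bimould.eval, MvPowerSeries.coeff_subst (hasSubst_elim _ _)]
  · refine finsum_congr fun d => ?_
    rw [Finsupp.prod_fintype _ _ (by simp), Fintype.prod_sum_type, Fin.prod_univ_two,
      Fin.prod_univ_two]
    rfl
  · intro i
    fin_cases i
    exacts [hx₁, hx₂]
  · intro i
    fin_cases i
    exacts [hy₁, hy₂]

theorem coeff_eval_X_Y (B : Bimould QSer) (a b c d : ℕ) :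
    MvPowerSeries.coeff (expTwo a b c d) (B.eval ![X₁] ![Y₁]) =
      if b = 0 ∧ d = 0 then MvPowerSeries.coeff (expOne a c) (B 1) else 0 := by
  rw [coeff_eval_one B (by simp) (by simp), finsum_eq_single _ (expOne a c)]
  · have h := coeff_monomial_expTwo a b c d a 0 c 0
    rw [pow_zero, pow_zero, mul_one, mul_one] at h
    change _ * MvPowerSeries.coeff _ (X₁ ^ a * Y₁ ^ c) = _
    rw [h]
    simp
  · intro e he
    have h := coeff_monomial_expTwo a b c d (e (.inl 0)) 0 (e (.inr 0)) 0
    rw [pow_zero, pow_zero, mul_one, mul_one] at h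
    rw [h, if_neg, mul_zero]
    rintro ⟨rfl, -, rfl, -⟩
    exact he (eq_expOne e)

theorem coeff_eval_X_add (B : Bimould QSer) (a b c d : ℕ) :
    MvPowerSeries.coeff (expTwo a b c d) (B.eval ![X₁] ![Y₁ + Y₂]) =
      if b = 0 then ((c + d).choose c : QSer) * MvPowerSeries.coeff (expOne a (c + d)) (B 1)
      else 0 := by
  rw [coeff_eval_one B (by simp) (by simp), finsum_eq_single _ (expOne a (c + d))]
  · rw [coeff_X_pow_mul_add_pow]
    change _ * (if a = a ∧ b = 0 ∧ c + d = c + d then ((c + d).choose c : QSer) else 0) = _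
    simp [mul_comm]
  · intro e he
    rw [coeff_X_pow_mul_add_pow, if_neg, mul_zero]
    rintro ⟨rfl, -, h⟩
    rw [← h] at he
    exact he (eq_expOne e)

theorem coeff_eval_add_sub (B : Bimould QSer) (a b c d : ℕ) :
    MvPowerSeries.coeff (expTwo a b c d) (B.eval ![X₁ + X₂, X₁] ![Y₂, Y₁ - Y₂]) =
      ∑ l ∈ Finset.HasAntidiagonal.antidiagonal (a + b),
        ∑ e ∈ Finset.HasAntidiagonal.antidiagonal (c + d),
        ((l.1.choose b : QSer) * (e.2.choose c : QSer) * (-1) ^ (e.2 - c)) *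
          MvPowerSeries.coeff (expTwo l.1 l.2 e.1 e.2) (B 2) := by
  classical
  rw [coeff_eval_two B (by simp) (by simp) (by simp) (by simp), ← Finset.sum_product']
  simp only [coeff_add_pow_mul_sub_pow]
  -- The substituted series are homogeneous of degree one in X and in Y separately, so only
  -- exponents of the same X- and Y-degree contribute.
  rw [finsum_eq_sum_of_support_subset (s := (Finset.HasAntidiagonal.antidiagonal (a + b) ×ˢ
    Finset.HasAntidiagonal.antidiagonal (c + d)).image fun p => expTwo p.1.1 p.1.2 p.2.1 p.2.2),
    Finset.sum_image]
  · refine Finset.sum_congr rfl fun p hp => ?_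
    rw [Finset.mem_product, Finset.HasAntidiagonal.mem_antidiagonal,
      Finset.HasAntidiagonal.mem_antidiagonal] at hp
    refine (mul_comm _ _).trans (congrArg (· * _) (if_pos hp))
  · rintro ⟨⟨_, _⟩, ⟨_, _⟩⟩ _ ⟨⟨_, _⟩, ⟨_, _⟩⟩ _ h
    obtain ⟨rfl, rfl, rfl, rfl⟩ := expTwo_inj.mp h
    rfl
  · intro e he
    rw [Function.mem_support] at he
    rw [Finset.coe_image]
    refine ⟨((e (.inl 0), e (.inl 1)), (e (.inr 0), e (.inr 1))), ?_, (eq_expTwo e).symm⟩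
    rw [Finset.mem_coe, Finset.mem_product, Finset.HasAntidiagonal.mem_antidiagonal,
      Finset.HasAntidiagonal.mem_antidiagonal]
    by_contra h
    exact he (by rw [if_neg h, mul_zero])

theorem Bimould.subst_vX_eval (B : Bimould QSer) (s : Fin 2 ⊕ Fin 2 ≃ Fin 2 ⊕ Fin 2) {r : ℕ}
    {x y : Fin r → MvPowerSeries (Fin 2 ⊕ Fin 2) QSer} (hx : ∀ i, (x i).constantCoeff = 0)
    (hy : ∀ i, (y i).constantCoeff = 0) :
    MvPowerSeries.subst (fun i => (MvPowerSeries.X (s i) :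
      MvPowerSeries (Fin 2 ⊕ Fin 2) QSer)) (B.eval x y) =
      B.eval
        (fun i => MvPowerSeries.subst (fun i => (MvPowerSeries.X (s i) :
          MvPowerSeries (Fin 2 ⊕ Fin 2) QSer)) (x i))
        (fun i => MvPowerSeries.subst (fun i => (MvPowerSeries.X (s i) :
          MvPowerSeries (Fin 2 ⊕ Fin 2) QSer)) (y i)) :=
  Bimould.eval_eval B x y _ hx hy (by simp)

/-- The exchange of the indices `1` and `2` of the variables. -/
def swapIdx : Fin 2 ⊕ Fin 2 ≃ Fin 2 ⊕ Fin 2 :=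
  Equiv.sumCongr (Equiv.swap 0 1) (Equiv.swap 0 1)

/-- Renaming of variables. -/
abbrev rename (s : Fin 2 ⊕ Fin 2 ≃ Fin 2 ⊕ Fin 2) :
    MvPowerSeries (Fin 2 ⊕ Fin 2) QSer → MvPowerSeries (Fin 2 ⊕ Fin 2) QSer :=
  MvPowerSeries.subst fun i => (MvPowerSeries.X (s i) : MvPowerSeries (Fin 2 ⊕ Fin 2) QSer)

theorem hasSubst_rename (s : Fin 2 ⊕ Fin 2 ≃ Fin 2 ⊕ Fin 2) :
    MvPowerSeries.HasSubst fun i => (MvPowerSeries.X (s i) :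
      MvPowerSeries (Fin 2 ⊕ Fin 2) QSer) :=
  MvPowerSeries.hasSubst_of_constantCoeff_zero (by simp)

theorem coeff_rename_swapIdx (f : MvPowerSeries (Fin 2 ⊕ Fin 2) QSer) (a b c d : ℕ) :
    MvPowerSeries.coeff (expTwo a b c d) (rename swapIdx f) =
      MvPowerSeries.coeff (expTwo b a d c) f := by
  rw [coeff_subst_equiv]
  congr 1
  refine congrArg _ (Finsupp.ext fun i => ?_)
  rw [Finsupp.mapDomain_equiv_apply]
  rcases i with i | i <;> fin_cases i <;> rfl

theorem coeff_rename_sumComm (f : MvPowerSeries (Fin 2 ⊕ Fin 2) QSer) (a b c d : ℕ) :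
    MvPowerSeries.coeff (expTwo a b c d) (rename (Equiv.sumComm _ _) f) =
      MvPowerSeries.coeff (expTwo c d a b) f := by
  rw [coeff_subst_equiv]
  congr 1
  refine congrArg _ (Finsupp.ext fun i => ?_)
  rw [Finsupp.mapDomain_equiv_apply]
  rcases i with i | i <;> fin_cases i <;> rfl

theorem rename_eval_one (B : Bimould QSer) (s : Fin 2 ⊕ Fin 2 ≃ Fin 2 ⊕ Fin 2)
    {x y : MvPowerSeries (Fin 2 ⊕ Fin 2) QSer} (hx : x.constantCoeff = 0)
    (hy : y.constantCoeff = 0) :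
    rename s (B.eval ![x] ![y]) = B.eval ![rename s x] ![rename s y] := by
  rw [rename, Bimould.subst_vX_eval B s]
  · congr 1 <;> ext1 i <;> fin_cases i <;> rfl
  · intro i
    fin_cases i
    exact hx
  · intro i
    fin_cases i
    exact hy

theorem rename_eval_two (B : Bimould QSer) (s : Fin 2 ⊕ Fin 2 ≃ Fin 2 ⊕ Fin 2)
    {x₁ x₂ y₁ y₂ : MvPowerSeries (Fin 2 ⊕ Fin 2) QSer} (hx₁ : x₁.constantCoeff = 0)
    (hx₂ : x₂.constantCoeff = 0) (hy₁ : y₁.constantCoeff = 0) (hy₂ : y₂.constantCoeff = 0) :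
    rename s (B.eval ![x₁, x₂] ![y₁, y₂]) =
      B.eval ![rename s x₁, rename s x₂] ![rename s y₁, rename s y₂] := by
  rw [rename, Bimould.subst_vX_eval B s]
  · congr 1 <;> ext1 i <;> fin_cases i <;> rfl
  · intro i
    fin_cases i
    exacts [hx₁, hx₂]
  · intro i
    fin_cases i
    exacts [hy₁, hy₂]

theorem rename_X (s : Fin 2 ⊕ Fin 2 ≃ Fin 2 ⊕ Fin 2) (i : Fin 2 ⊕ Fin 2) :
    rename s (MvPowerSeries.X i) = MvPowerSeries.X (s i) :=
  MvPowerSeries.subst_X (hasSubst_rename s) i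

theorem rename_add (s : Fin 2 ⊕ Fin 2 ≃ Fin 2 ⊕ Fin 2) (f g : MvPowerSeries (Fin 2 ⊕ Fin 2) QSer) :
    rename s (f + g) = rename s f + rename s g :=
  MvPowerSeries.subst_add (hasSubst_rename s) f g

theorem rename_sub (s : Fin 2 ⊕ Fin 2 ≃ Fin 2 ⊕ Fin 2) (f g : MvPowerSeries (Fin 2 ⊕ Fin 2) QSer) :
    rename s (f - g) = rename s f - rename s g :=
  MvPowerSeries.subst_sub (hasSubst_rename s) f g

theorem rename_mul (s : Fin 2 ⊕ Fin 2 ≃ Fin 2 ⊕ Fin 2) (f g : MvPowerSeries (Fin 2 ⊕ Fin 2) QSer) :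
    rename s (f * g) = rename s f * rename s g :=
  MvPowerSeries.subst_mul (hasSubst_rename s) f g

theorem eval_X_Y (B : Bimould QSer) : B.eval ![X₁, X₂] ![Y₁, Y₂] = B 2 := by
  have h : Sum.elim ![X₁, X₂] ![Y₁, Y₂] = MvPowerSeries.X := by
    ext1 i
    rcases i with i | i <;> fin_cases i <;> rfl
  rw [Bimould.eval, h, MvPowerSeries.subst_self, id]

theorem coeff_eval_two_swap (B : Bimould QSer) (a b c d : ℕ) :
    MvPowerSeries.coeff (expTwo a b c d) (B.eval ![X₂, X₁] ![Y₂, Y₁]) =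
      MvPowerSeries.coeff (expTwo b a d c) (B 2) := by
  rw [← eval_X_Y B, ← coeff_rename_swapIdx, rename_eval_two B _ (by simp) (by simp) (by simp)
    (by simp)]
  simp only [rename_X]
  rfl

theorem coeff_eval_X_Y_two (B : Bimould QSer) (a b c d : ℕ) :
    MvPowerSeries.coeff (expTwo a b c d) (B.eval ![X₂] ![Y₂]) =
      if a = 0 ∧ c = 0 then MvPowerSeries.coeff (expOne b d) (B 1) else 0 := by
  rw [← coeff_eval_X_Y B b a d c, ← coeff_rename_swapIdx, rename_eval_one B _ (by simp) (by simp)]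
  simp only [rename_X]
  rfl

/-- X₁ does not occur in this series. Comparing coefficients at positive powers of X₁ therefore
removes one half of the divided difference. -/
theorem coeff_eval_X_add_two (B : Bimould QSer) (a b c d : ℕ) :
    MvPowerSeries.coeff (expTwo (a + 1) b c d) (B.eval ![X₂] ![Y₁ + Y₂]) = 0 := by
  have h := coeff_eval_X_add B b (a + 1) d c
  rw [if_neg (by omega), ← coeff_rename_swapIdx, rename_eval_one B _ (by simp) (by simp)] at h
  simp only [rename_X, rename_add] at h
  rw [add_comm (MvPowerSeries.X _)] at h
  exact h

theorem coeff_eval_add_sub_swap (B : Bimould QSer) (a b c d : ℕ) :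
    MvPowerSeries.coeff (expTwo a b c d) (B.eval ![X₁ + X₂, X₂] ![Y₁, Y₂ - Y₁]) =
      MvPowerSeries.coeff (expTwo b a d c) (B.eval ![X₁ + X₂, X₁] ![Y₂, Y₁ - Y₂]) := by
  rw [← coeff_rename_swapIdx, rename_eval_two B _ (by simp) (by simp) (by simp) (by simp)]
  simp only [rename_X, rename_add, rename_sub]
  rw [add_comm (vX QSer 0)]
  rfl

/-- The factors involve disjoint sets of variables, so an exponent splits in only one way. -/
theorem coeff_eval_mul_eval (B : Bimould QSer) (a b c d : ℕ) :
    MvPowerSeries.coeff (expTwo a b c d) (B.eval ![X₁] ![Y₁] * B.eval ![X₂] ![Y₂]) =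
      MvPowerSeries.coeff (expOne a c) (B 1) * MvPowerSeries.coeff (expOne b d) (B 1) := by
  classical
  rw [MvPowerSeries.coeff_mul, Finset.sum_eq_single (expTwo a 0 c 0, expTwo 0 b 0 d)]
  · rw [coeff_eval_X_Y, coeff_eval_X_Y_two, if_pos ⟨rfl, rfl⟩, if_pos ⟨rfl, rfl⟩]
  · rintro ⟨e, e'⟩ he hne
    rw [Finset.HasAntidiagonal.mem_antidiagonal] at he
    simp only at he ⊢
    have h := eq_expTwo e
    have h' := eq_expTwo e'
    generalize e (.inl 0) = p, e (.inl 1) = q, e (.inr 0) = r, e (.inr 1) = s at h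
    generalize e' (.inl 0) = p', e' (.inl 1) = q', e' (.inr 0) = r', e' (.inr 1) = s' at h'
    subst h h'
    have hadd : expTwo p q r s + expTwo p' q' r' s' = expTwo (p + p') (q + q') (r + r') (s + s') :=
      eq_expTwo _
    obtain ⟨h1, h2, h3, h4⟩ := expTwo_inj.mp (hadd.symm.trans he)
    rw [coeff_eval_X_Y, coeff_eval_X_Y_two]
    split_ifs with hc hc'
    · obtain ⟨rfl, rfl⟩ := hc
      obtain ⟨rfl, rfl⟩ := hc'
      simp only [add_zero, zero_add] at h1 h2 h3 h4
      subst h1 h2 h3 h4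
      exact absurd rfl hne
    all_goals simp
  · intro h
    refine absurd ?_ h
    rw [Finset.HasAntidiagonal.mem_antidiagonal]
    refine (eq_expTwo _).trans (expTwo_inj.mpr ⟨?_, ?_, ?_, ?_⟩)
    · exact add_zero a
    · exact zero_add b
    · exact add_zero c
    · exact zero_add d

section

variable {β : Mould ℚ} (hβ : IsRationalSolution β)
include hβ

theorem IsRationalSolution.coeff_depth_one_symm (a c : ℕ) :
    MvPowerSeries.coeff (expOne a c) (frakG β 1) =
      MvPowerSeries.coeff (expOne c a) (frakG β 1) := by
  have h := congrArg (MvPowerSeries.coeff (expTwo c 0 a 0))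
    (hβ.frakG_swap_one (x := X₁) (y := Y₁) (by simp) (by simp))
  have h' : (frakG β).eval ![Y₁] ![X₁] =
      rename (Equiv.sumComm _ _) ((frakG β).eval ![X₁] ![Y₁]) := by
    rw [rename_eval_one _ _ (by simp) (by simp), rename_X, rename_X]
    rfl
  rw [h', coeff_rename_sumComm, coeff_eval_X_Y, coeff_eval_X_Y, if_pos ⟨rfl, rfl⟩,
    if_pos ⟨rfl, rfl⟩] at h
  exact h.symm

theorem IsRationalSolution.coeff_frakG_mul_frakG_sub (a b c d : ℕ) :
    MvPowerSeries.coeff (expTwo a b c d)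
      ((frakG β).eval ![X₁] ![Y₁] * (frakG β).eval ![X₂] ![Y₂] -
      (frakG β).eval ![X₁, X₂] ![Y₁, Y₂] - (frakG β).eval ![X₂, X₁] ![Y₂, Y₁]) =
    ((c + d).choose c : QSer) * MvPowerSeries.coeff (expOne (a + b + 1) (c + d)) (frakG β 1) := by
  have key := hβ.frakG_mul_frakG (x₁ := X₁) (x₂ := X₂) (y₁ := Y₁) (y₂ := Y₂) (by simp) (by simp)
    (by simp) (by simp)
  generalize (frakG β).eval ![X₁] ![Y₁] * (frakG β).eval ![X₂] ![Y₂] -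
      (frakG β).eval ![X₁, X₂] ![Y₁, Y₂] - (frakG β).eval ![X₂, X₁] ![Y₂, Y₁] = W at key ⊢
  have h1 (a b : ℕ) : expTwo (a + 1) b c d - Finsupp.single (.inl 0) 1 = expTwo a b c d := by
    ext i
    rw [Finsupp.tsub_apply, Finsupp.single_apply]
    rcases i with i | i <;> fin_cases i <;> simp [expTwo]
  have h2 (a b : ℕ) : expTwo a (b + 1) c d - Finsupp.single (.inl 1) 1 = expTwo a b c d := by
    ext i
    rw [Finsupp.tsub_apply, Finsupp.single_apply]
    rcases i with i | i <;> fin_cases i <;> simp [expTwo]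
  -- Compare coefficients of X₁^{a+1}X₂^b in (X₁-X₂)W. For b = 0 this determines the coefficient of
  -- X₁^a in W; for b + 1 it says that the coefficients of X₁^aX₂^{b+1} and X₁^{a+1}X₂^b agree.
  induction b generalizing a with
  | zero =>
    have h := congrArg (MvPowerSeries.coeff (expTwo (a + 1) 0 c d)) key
    rw [sub_mul, map_sub, map_sub, coeff_X_mul_eq, coeff_X_mul_eq, coeff_eval_X_add,
      coeff_eval_X_add_two, if_pos (show 1 ≤ expTwo (a + 1) 0 c d (.inl 0) from Nat.le_add_left 1 a),
      if_neg (show ¬1 ≤ expTwo (a + 1) 0 c d (.inl 1) from Nat.not_succ_le_zero 0),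
      if_pos rfl, sub_zero, sub_zero, h1] at h
    exact h
  | succ b ih =>
    have h := congrArg (MvPowerSeries.coeff (expTwo (a + 1) (b + 1) c d)) key
    rw [sub_mul, map_sub, map_sub, coeff_X_mul_eq, coeff_X_mul_eq, coeff_eval_X_add,
      coeff_eval_X_add_two,
      if_pos (show 1 ≤ expTwo (a + 1) (b + 1) c d (.inl 0) from Nat.le_add_left 1 a),
      if_pos (show 1 ≤ expTwo (a + 1) (b + 1) c d (.inl 1) from Nat.le_add_left 1 b),
      if_neg (Nat.succ_ne_zero b), sub_zero, h1, h2, ih, sub_eq_zero] at h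
    rw [h, add_right_comm a 1 b, add_assoc a b 1]

/-- The quasi-shuffle relation for the coefficients of `𝔊`. -/
theorem IsRationalSolution.coeff_mul_coeff_stuffle (a b c d : ℕ) :
    MvPowerSeries.coeff (expOne a c) (frakG β 1) * MvPowerSeries.coeff (expOne b d) (frakG β 1) =
      MvPowerSeries.coeff (expTwo a b c d) (frakG β 2) +
      MvPowerSeries.coeff (expTwo b a d c) (frakG β 2) +
      ((c + d).choose c : QSer) * MvPowerSeries.coeff (expOne (a + b + 1) (c + d)) (frakG β 1) := by
  rw [← hβ.coeff_frakG_mul_frakG_sub, map_sub, map_sub, coeff_eval_mul_eval, eval_X_Y,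
    coeff_eval_two_swap]
  ring

/-- The shuffle relation for the coefficients of `𝔊`. -/
theorem IsRationalSolution.coeff_mul_coeff_shuffle (a b c d : ℕ) :
    MvPowerSeries.coeff (expOne a c) (frakG β 1) * MvPowerSeries.coeff (expOne b d) (frakG β 1) =
      (∑ l ∈ Finset.HasAntidiagonal.antidiagonal (a + b),
        ∑ e ∈ Finset.HasAntidiagonal.antidiagonal (c + d),
        ((l.1.choose b : QSer) * (e.2.choose c : QSer) * (-1) ^ (e.2 - c)) *
          MvPowerSeries.coeff (expTwo l.1 l.2 e.1 e.2) (frakG β 2)) +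
      (∑ l ∈ Finset.HasAntidiagonal.antidiagonal (a + b),
        ∑ e ∈ Finset.HasAntidiagonal.antidiagonal (c + d),
        ((l.1.choose a : QSer) * (e.2.choose d : QSer) * (-1) ^ (e.2 - d)) *
          MvPowerSeries.coeff (expTwo l.1 l.2 e.1 e.2) (frakG β 2)) +
      ((a + b).choose a : QSer) * MvPowerSeries.coeff (expOne (a + b) (c + d + 1)) (frakG β 1) := by
  -- The quasi-shuffle relation with the roles of X and Y exchanged.
  have h := hβ.coeff_frakG_mul_frakG_sub c d a b
  rw [← coeff_rename_sumComm, rename_sub, rename_sub, rename_mul, rename_eval_one _ _ (by simp)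
    (by simp), rename_eval_one _ _ (by simp) (by simp), rename_eval_two _ _ (by simp) (by simp)
    (by simp) (by simp), rename_eval_two _ _ (by simp) (by simp) (by simp) (by simp)] at h
  simp only [rename_X] at h
  change MvPowerSeries.coeff (expTwo a b c d)
      ((frakG β).eval ![Y₁] ![X₁] * (frakG β).eval ![Y₂] ![X₂] -
      (frakG β).eval ![Y₁, Y₂] ![X₁, X₂] - (frakG β).eval ![Y₂, Y₁] ![X₂, X₁]) = _ at h
  -- The swap restores the product on the left and turns the depth two terms into
  -- 𝔊(X₁+X₂,X₁;Y₂,Y₁-Y₂) and its mirror image, whose expansion gives the binomial sums.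
  rw [hβ.frakG_swap_one (by simp) (by simp), hβ.frakG_swap_one (x := Y₂) (by simp) (by simp),
    hβ.frakG_swap_two (by simp) (by simp) (by simp) (by simp),
    hβ.frakG_swap_two (x₁ := Y₂) (by simp) (by simp) (by simp) (by simp), add_comm X₂ X₁,
    map_sub, map_sub, coeff_eval_mul_eval, coeff_eval_add_sub_swap, coeff_eval_add_sub,
    coeff_eval_add_sub, add_comm b a, add_comm d c, hβ.coeff_depth_one_symm (c + d + 1)] at h
  rw [← h]
  ring

end

/-! ### From exponents to indices, and the product formulas -/

theorem G_one (β : Mould ℚ) (k d : ℕ) :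
    G β ![k] ![d] = (d.factorial : ℚ) • MvPowerSeries.coeff (expOne (k - 1) d) (frakG β 1) := by
  rw [G, Bimould.coeff, Fin.prod_univ_one, Nat.cast_smul_eq_nsmul]
  congr 2
  refine congrArg _ (Finsupp.ext fun i => ?_)
  rcases i with i | i <;> fin_cases i <;> rfl

theorem G_two (β : Mould ℚ) (k₁ k₂ d₁ d₂ : ℕ) :
    G β ![k₁, k₂] ![d₁, d₂] = (d₁.factorial * d₂.factorial : ℚ) •
      MvPowerSeries.coeff (expTwo (k₁ - 1) (k₂ - 1) d₁ d₂) (frakG β 2) := by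
  rw [G, Bimould.coeff, Fin.prod_univ_two, ← Nat.cast_mul, Nat.cast_smul_eq_nsmul]
  congr 2
  refine congrArg _ (Finsupp.ext fun i => ?_)
  rcases i with i | i <;> fin_cases i <;> rfl

/-- With j = d₁ - e₁ = e₂ - d₂ both sides are (-1)^j d₁! e₂!/j!; for e₁ > d₁ both binomials vanish.
This reconciles the binomials from expanding powers of Y₁ - Y₂ with those for the normalisation
Y^d/d!. -/
theorem factorial_mul_choose {d₁ d₂ e₁ e₂ : ℕ} (h : e₁ + e₂ = d₁ + d₂) :
    (d₁.factorial * d₂.factorial : ℚ) * (e₂.choose d₂ * (-1) ^ (e₂ - d₂)) =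
      (d₁.choose e₁ * (-1) ^ (d₁ - e₁)) * (e₁.factorial * e₂.factorial) := by
  by_cases he : e₁ ≤ d₁
  · obtain ⟨j, rfl⟩ := Nat.exists_eq_add_of_le he
    obtain rfl : e₂ = d₂ + j := by omega
    rw [Nat.cast_add_choose, Nat.cast_add_choose, Nat.add_sub_cancel_left, Nat.add_sub_cancel_left]
    have := Nat.factorial_ne_zero d₂
    have := Nat.factorial_ne_zero e₁
    have := Nat.factorial_ne_zero j
    field_simp
  · rw [Nat.choose_eq_zero_of_lt (not_le.mp he), Nat.choose_eq_zero_of_lt (by omega : e₂ < d₂)]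
    simp

/-- The shift by one between an index l ≥ 1 and the exponent l - 1. -/
theorem sum_antidiagonal_pos {M : Type*} [AddCommMonoid M] {k₁ k₂ : ℕ} (hk₁ : 1 ≤ k₁)
    (hk₂ : 1 ≤ k₂) (f : ℕ × ℕ → M) :
    ∑ l ∈ Finset.HasAntidiagonal.antidiagonal (k₁ + k₂) with 1 ≤ l.1 ∧ 1 ≤ l.2, f l =
      ∑ l ∈ Finset.HasAntidiagonal.antidiagonal (k₁ - 1 + (k₂ - 1)), f (l.1 + 1, l.2 + 1) := by
  refine Finset.sum_nbij' (fun l => (l.1 - 1, l.2 - 1)) (fun l => (l.1 + 1, l.2 + 1)) ?_ ?_ ?_ ?_ ?_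
  · rintro ⟨a, b⟩ h
    simp at h ⊢
    omega
  · rintro ⟨a, b⟩ h
    simp at h ⊢
    omega
  · rintro ⟨a, b⟩ h
    simp at h ⊢
    omega
  · rintro ⟨a, b⟩ h
    simp
  · rintro ⟨a, b⟩ h
    simp at h ⊢
    rw [Nat.sub_add_cancel (by omega), Nat.sub_add_cancel (by omega)]

end CombEis

end

theorem proposition5p4 (β : CombEis.Mould ℚ) (hβ : CombEis.IsRationalSolution β)
    (k₁ k₂ d₁ d₂ : ℕ) (hk₁ : 1 ≤ k₁) (hk₂ : 1 ≤ k₂) :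
    CombEis.G β ![k₁] ![d₁] * CombEis.G β ![k₂] ![d₂] =
        CombEis.G β ![k₁, k₂] ![d₁, d₂] + CombEis.G β ![k₂, k₁] ![d₂, d₁] +
          CombEis.G β ![k₁ + k₂] ![d₁ + d₂] ∧
    CombEis.G β ![k₁] ![d₁] * CombEis.G β ![k₂] ![d₂] =
        (∑ l ∈ Finset.HasAntidiagonal.antidiagonal (k₁ + k₂) with 1 ≤ l.1 ∧ 1 ≤ l.2,
          ∑ e ∈ Finset.HasAntidiagonal.antidiagonal (d₁ + d₂),
            (((l.1 - 1).choose (k₁ - 1) : ℚ) * (d₁.choose e.1 : ℚ) * (-1) ^ (d₁ - e.1) +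
              ((l.1 - 1).choose (k₂ - 1) : ℚ) * (d₂.choose e.1 : ℚ) * (-1) ^ (d₂ - e.1)) •
              CombEis.G β ![l.1, l.2] ![e.1, e.2]) +
          (((d₁.factorial : ℚ) * (d₂.factorial : ℚ) / ((d₁ + d₂ + 1).factorial : ℚ)) *
            ((k₁ + k₂ - 2).choose (k₁ - 1) : ℚ)) •
            CombEis.G β ![k₁ + k₂ - 1] ![d₁ + d₂ + 1] := by
  have hsmul (n : ℕ) (f : CombEis.QSer) : (n : CombEis.QSer) * f = (n : ℚ) • f := by
    rw [Nat.cast_smul_eq_nsmul, nsmul_eq_mul]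
  have hmul (x y : ℚ) (f g : CombEis.QSer) : (x • f) * (y • g) = (x * y) • (f * g) :=
    smul_mul_smul_comm x f y g
  constructor
  · rw [CombEis.G_one, CombEis.G_one, CombEis.G_one, CombEis.G_two, CombEis.G_two, hmul,
      hβ.coeff_mul_coeff_stuffle, hsmul, smul_add, smul_add, smul_smul,
      mul_comm (d₂.factorial : ℚ)]
    congr 1
    -- The binomial coefficient from (Y₁+Y₂)^{d₁+d₂} times d₁! d₂! is (d₁+d₂)!, the normalisation of
    -- the depth one term.
    rw [(by omega : k₁ - 1 + (k₂ - 1) + 1 = k₁ + k₂ - 1), ← Nat.cast_mul, ← Nat.cast_mul,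
      mul_comm, ← mul_assoc, Nat.choose_symm_add, Nat.add_choose_mul_factorial_mul_factorial]
  · rw [CombEis.sum_antidiagonal_pos hk₁ hk₂]
    simp only [CombEis.G_one, CombEis.G_two, hmul]
    rw [hβ.coeff_mul_coeff_shuffle, hsmul, smul_add, smul_smul, smul_smul,
      ← Finset.sum_add_distrib, Finset.smul_sum]
    congr 1
    · refine Finset.sum_congr rfl fun l _ => ?_
      rw [← Finset.sum_add_distrib, Finset.smul_sum]
      refine Finset.sum_congr rfl fun e he => ?_
      rw [Finset.HasAntidiagonal.mem_antidiagonal] at he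
      have h1 := CombEis.factorial_mul_choose he
      -- The mirror term needs the same identity with d₁ and d₂ exchanged.
      have h2 := CombEis.factorial_mul_choose (he.trans (add_comm d₁ d₂))
      simp only [Nat.add_sub_cancel]
      have hc (p q n : ℕ) (f : CombEis.QSer) :
          ((p : CombEis.QSer) * (q : CombEis.QSer) * (-1) ^ n) * f =
            ((p : ℚ) * q * (-1) ^ n) • f := by
        rw [Algebra.smul_def, map_mul, map_mul, map_natCast, map_natCast, map_pow, map_neg, map_one]
      rw [hc, hc, ← add_smul, smul_smul, smul_smul]
      congr 1
      linear_combination ((l.1.choose (k₁ - 1) : ℚ)) * h1 + ((l.1.choose (k₂ - 1) : ℚ)) * h2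
    · rw [(by omega : k₁ - 1 + (k₂ - 1) = k₁ + k₂ - 2), (by omega : k₁ + k₂ - 1 - 1 = k₁ + k₂ - 2)]
      congr 1
      have := Nat.factorial_ne_zero (d₁ + d₂ + 1)
      field_simp
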